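/- Consider the two-sorted language with a sort of points (variables $t$) and a sort of sets (variables $s$), a binary relation $<$ on sets, a unary function $f$ from points to sets, and a 4-ary relation $C(t_1,t_2,t_3,s)$. Let $T$ be the theory with the following axioms. 1. $<$ is a dense linear order without end points on the sets. 2. For every set $s$ the fibre $f^{-1}(s)=\{t \mid f(t)=s\}$ is infinite, and $C(-,-,-,s)$ is a dense circular order on it. That is, on $f^{-1}(s)$ the relation is cyclic, asymmetric, transitive ($C(a,b,c,s)\wedge C(a,c,d,s)\to C(a,b,d,s)$) and total on triples of distinct points, and for all $t_1\neq t_2$ in $f^{-1}(s)$ there is $t_3$ with $C(t_1,t_3,t_2,s)$. Moreover $C(t_1,t_2,t_3,s)$ implies $f(t_i)=s$ for $i=1,2,3$. (A two-sorted structure is regarded as a one-sorted structure with a unary predicate for each sort, and $f$ is extended by $f(s)=s$ for sets $s$. Models are non-empty.) A formula $\varphi(x,b)$ divides over a set $A$ if there are $k<\omega$ and a sequence $(b_i)_{i<\omega}$ with $b_i\equiv_A b$ for all $i$ such that no $k$ of the formulas $\varphi(x,b_i)$ (with distinct indices) have a common realization. It forks over $A$ if it implies a finite disjunction of formulas (with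 parameters), each of which divides over $A$. A set $A$ is an extension base (for non-forking) if for every finite tuple $a$ no formula of $\mathrm{tp}(a/A)$ forks over $A$; it is a good extension base if every small $B\supseteq A$ is an extension base. Below, these notions are evaluated in an $|M|^+$-saturated elementary extension $M_1$ of a model $M$, and small means of cardinality at most $|M|$. Then: (i) $T$ is complete, has quantifier elimination, and is dependent (NIP): in no model are there a formula $\varphi(x,y)$ and tuples $(a_i)_{i<\omega}$, $(b_w)_{w\subseteq\omega}$ with $\varphi(a_i,b_w)\iff i\in w$. (ii) There exist a model $M$ of $T$ and an elementary extension $M_1$ of $M$ which is $|M|^+$-saturated. (iii) Let $M$ be any model of $T$ and $M_1$ any $|M|^+$-saturated elementary extension of $M$. Then there is an element $s\in M_1\setminus M$ of the sort of sets. For every such $s$, the formula "$x$ is a point and $f(x)=s$" forks but does not divide over $M\cup\{s\}$, and $M\cup\{s\}$ is not an extension base for non-forking. Consequently $M$ is not a good extension base for non-forking. -/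

import Mathlib

open FirstOrder

universe u

namespace ForkDiv

open FirstOrder.Language

/-! ### General notions, for an arbitrary first-order language

The structure `N` plays the role of the monster model. A formula with parameters `φ(x, b)` is given
by `φ : L.Formula (α ⊕ β)`, where `α` indexes the variables `x` and `β` indexes the parameters
`b : β → N`. A formula over a set `A`, in variables indexed by `β`, is a formula with variables in
`A ⊕ β`, in which a variable `a : A` is interpreted by itself. -/

section General

variable {L : FirstOrder.Language.{0, 0}} {N : Type u} [L.Structure N]

/-- `a ≡_A b`: the tuples `a` and `b` satisfy the same formulas over `A`. -/
def EquivOver {β : Type} (A : Set N) (a b : β → N) : Prop :=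
  ∀ φ : L.Formula (A ⊕ β),
    φ.Realize (Sum.elim (fun c : A => (c : N)) a) ↔ φ.Realize (Sum.elim (fun c : A => (c : N)) b)

/-- The family `φ(x, a i)`, `i < ω`, is `k`-inconsistent: no `k` of its members (at different
indices) have a common realization. -/
def KInconsistent {α β : Type} (k : ℕ) (φ : L.Formula (α ⊕ β)) (a : ℕ → β → N) : Prop :=
  ∀ s : Finset ℕ, s.card = k → ¬ ∃ x : α → N, ∀ i ∈ s, φ.Realize (Sum.elim x (a i))

/-- `φ(x, b)` divides over `A`. -/
def Divides {α β : Type} (A : Set N) (φ : L.Formula (α ⊕ β)) (b : β → N) : Prop :=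
  ∃ (k : ℕ) (a : ℕ → β → N), (∀ i, EquivOver (L := L) A (a i) b) ∧ KInconsistent k φ a

/-- `φ(x, b)` forks over `A`: it implies a finite disjunction of formulas (with parameters in `N`),
each of which divides over `A`. -/
def Forks {α β : Type} (A : Set N) (φ : L.Formula (α ⊕ β)) (b : β → N) : Prop :=
  ∃ (n : ℕ) (m : Fin n → ℕ) (ψ : ∀ i, L.Formula (α ⊕ Fin (m i))) (c : ∀ i, Fin (m i) → N),
    (∀ x : α → N, φ.Realize (Sum.elim x b) → ∃ i, (ψ i).Realize (Sum.elim x (c i))) ∧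
    ∀ i, Divides A (ψ i) (c i)

variable (L)

/-- Nonforking independence of `a` from `B` over `C`: no formula with parameters from `B ∪ C`
that is satisfied by `a` forks over `C`; that is, `tp(a / B ∪ C)` does not fork over `C`. -/
def NonforkingIndep {α : Type} (a : α → N) (C B : Set N) : Prop :=
  ∀ (m : ℕ) (φ : L.Formula (α ⊕ Fin m)) (b : Fin m → N),
    (∀ j, b j ∈ B ∪ C) → φ.Realize (Sum.elim a b) → ¬ Forks C φ b

/-- `A` is an extension base for nonforking: every tuple is independent from `A` over `A`. -/
def IsExtensionBase (A : Set N) : Prop :=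
  ∀ (n : ℕ) (a : Fin n → N), NonforkingIndep L a A A

/-- `A` is a good extension base for nonforking: every set `B ⊇ A` which is small, i.e. of
cardinality less than `κ`, is an extension base. -/
def IsGoodExtensionBase (κ : Cardinal.{u}) (A : Set N) : Prop :=
  ∀ B : Set N, A ⊆ B → Cardinal.mk B < κ → IsExtensionBase L B

variable (N)

/-- `N` is `κ`-saturated: over every `A ⊆ N` with `#A < κ`, every set of formulas in one variable
over `A` that is finitely satisfiable in `N` is realized in `N`. -/
def IsSaturated (κ : Cardinal.{u}) : Prop :=
  ∀ A : Set N, Cardinal.mk A < κ → ∀ p : Set (L.Formula (A ⊕ Unit)),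
    (∀ q : Finset (L.Formula (A ⊕ Unit)), (q : Set (L.Formula (A ⊕ Unit))) ⊆ p →
      ∃ x : N, ∀ φ ∈ q, φ.Realize (Sum.elim (fun c : A => (c : N)) fun _ => x)) →
    ∃ x : N, ∀ φ ∈ p, φ.Realize (Sum.elim (fun c : A => (c : N)) fun _ => x)

variable {L}

/-- `T` is dependent (NIP): in no model of `T` are there a formula `φ(x, y)` and tuples
`a i` (`i < ω`), `b w` (`w ⊆ ω`) such that `φ(a i, b w)` holds if and only if `i ∈ w`. -/
def IsDependent (T : L.Theory) : Prop :=
  ¬ ∃ (P : Theory.ModelType.{0, 0, u} T) (n m : ℕ) (φ : L.Formula (Fin n ⊕ Fin m))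
      (a : ℕ → Fin n → P) (b : Set ℕ → Fin m → P),
    ∀ i w, φ.Realize (Sum.elim (a i) (b w)) ↔ i ∈ w

/-- `T` eliminates quantifiers: modulo `T`, every formula is equivalent to a quantifier-free
formula in the same variables. -/
def HasQE (T : L.Theory) : Prop :=
  ∀ (n : ℕ) (φ : L.Formula (Fin n)),
    ∃ ψ : L.Formula (Fin n), BoundedFormula.IsQF ψ ∧ T.Iff φ ψ

end General

/-! ### The two-sorted language and the theory

The two sorts are unary predicates `point` and `set`; the function `f` from points to sets is made
total by the convention `f s = s` for `s` in the sort `set`. -/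

/-- The function symbols: one unary symbol `f`. -/
inductive Func : ℕ → Type
  | f : Func 1

/-- The relation symbols: the two sorts, the order `<` on sets, and the 4-ary relation
`C(t₁, t₂, t₃, s)`. -/
inductive Rel : ℕ → Type
  | point : Rel 1
  | set : Rel 1
  | lt : Rel 2
  | circ : Rel 4

/-- The language. -/
abbrev Lang : FirstOrder.Language.{0, 0} := ⟨Func, Rel⟩

section Formulas

variable {α : Type} {n : ℕ}

/-- The term `f(t)`. -/
def fT (t : Lang.Term α) : Lang.Term α :=
  Functions.apply₁ (L := Lang) Func.f t

/-- `t` is a point. -/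
def isPoint (t : Lang.Term (α ⊕ Fin n)) : Lang.BoundedFormula α n :=
  Relations.boundedFormula₁ (L := Lang) Rel.point t

/-- `t` is a set. -/
def isSet (t : Lang.Term (α ⊕ Fin n)) : Lang.BoundedFormula α n :=
  Relations.boundedFormula₁ (L := Lang) Rel.set t

/-- `t₁ < t₂`. -/
def lessThan (t₁ t₂ : Lang.Term (α ⊕ Fin n)) : Lang.BoundedFormula α n :=
  Relations.boundedFormula₂ (L := Lang) Rel.lt t₁ t₂

/-- `C(t₁, t₂, t₃, s)`. -/
def circ (t₁ t₂ t₃ s : Lang.Term (α ⊕ Fin n)) : Lang.BoundedFormula α n :=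
  Relations.boundedFormula (L := Lang) Rel.circ ![t₁, t₂, t₃, s]

/-- `t` is a point of the fibre `f⁻¹(s)`. -/
def inFibre (t s : Lang.Term (α ⊕ Fin n)) : Lang.BoundedFormula α n :=
  isPoint t ⊓ (fT t =' s)

end Formulas

/-- Every element is of exactly one of the two sorts; `f` takes values in the sort of sets, and is
the identity there (the convention that makes `f` total). -/
def sortAxioms : Lang.Theory :=
  { ∀' ((isPoint &0 ⊔ isSet &0) ⊓ ∼(isPoint &0 ⊓ isSet &0)),
    ∀' (isSet (fT &0)),
    ∀' (isSet &0 ⟹ fT &0 =' &0) }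

/-- `<` is a relation on the sort of sets, and is there a strict dense linear order without
end points. -/
def orderAxioms : Lang.Theory :=
  { ∀' ∀' (lessThan &0 &1 ⟹ isSet &0 ⊓ isSet &1),
    ∀' ∼(lessThan &0 &0),
    ∀' ∀' ∀' (lessThan &0 &1 ⊓ lessThan &1 &2 ⟹ lessThan &0 &2),
    ∀' ∀' (isSet &0 ⊓ isSet &1 ⟹ lessThan &0 &1 ⊔ (&0 =' &1 ⊔ lessThan &1 &0)),
    ∀' ∀' (lessThan &0 &1 ⟹ ∃' (lessThan &0 &2 ⊓ lessThan &2 &1)),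
    ∀' (isSet &0 ⟹ ∃' (lessThan &1 &0)),
    ∀' (isSet &0 ⟹ ∃' (lessThan &0 &1)) }

/-- `C(t₁, t₂, t₃, s)` implies that `t₁, t₂, t₃` are points of the fibre of `s`; and for every `s`
the relation `C(-, -, -, s)` is a dense (strict) circular order on that fibre: it is cyclic,
asymmetric, transitive, total on distinct points, and dense. The variable `s` is the first quantified
variable `&0`. -/
def circularAxioms : Lang.Theory :=
  { ∀' ∀' ∀' ∀' (circ &1 &2 &3 &0 ⟹ inFibre &1 &0 ⊓ (inFibre &2 &0 ⊓ inFibre &3 &0)),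
    ∀' ∀' ∀' ∀' (circ &1 &2 &3 &0 ⟹ circ &2 &3 &1 &0),
    ∀' ∀' ∀' ∀' (circ &1 &2 &3 &0 ⟹ ∼(circ &3 &2 &1 &0)),
    ∀' ∀' ∀' ∀' ∀' (circ &1 &2 &3 &0 ⊓ circ &1 &3 &4 &0 ⟹ circ &1 &2 &4 &0),
    ∀' ∀' ∀' ∀' (inFibre &1 &0 ⊓ (inFibre &2 &0 ⊓ inFibre &3 &0) ⟹
      ∼(&1 =' &2) ⊓ (∼(&2 =' &3) ⊓ ∼(&1 =' &3)) ⟹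
      circ &1 &2 &3 &0 ⊔ circ &3 &2 &1 &0),
    ∀' ∀' ∀' (inFibre &1 &0 ⊓ inFibre &2 &0 ⟹ ∼(&1 =' &2) ⟹ ∃' (circ &1 &3 &2 &0)) }

/-- The `k`-th axiom expressing that fibres are infinite: for every set `s` and all
`t₁, …, t_k` there is a point in the fibre of `s` that is different from all `t_i`. -/
noncomputable def infiniteFibre (k : ℕ) : Lang.Sentence :=
  BoundedFormula.alls (α := Empty) (n := k + 1)
    (isSet (Term.var (Sum.inr 0)) ⟹
      ∃' (inFibre (Term.var (Sum.inr (Fin.last (k + 1)))) (Term.var (Sum.inr 0)) ⊓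
        BoundedFormula.iInf fun i : Fin k =>
          ∼(Term.var (Sum.inr (Fin.last (k + 1))) =' Term.var (Sum.inr i.succ.castSucc))))

/-- The theory: a dense linear order without end points on the sets, and a dense circular order on
every fibre `f⁻¹(s)`, all fibres being infinite. -/
noncomputable def fibreTheory : Lang.Theory :=
  sortAxioms ∪ orderAxioms ∪ circularAxioms ∪ Set.range infiniteFibre

/-- The formula `f(x) = s` (`x` a point), with variable `x` and parameter `s`. -/
def fibreFormula : Lang.Formula (Fin 1 ⊕ Fin 1) :=
  inFibre (Term.var (Sum.inl (Sum.inl 0))) (Term.var (Sum.inl (Sum.inr 0)))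

/-- The element `s` of a structure lies in the sort of sets. -/
def InSets {N : Type u} [Lang.Structure N] (s : N) : Prop :=
  Structure.RelMap (L := Lang) Rel.set ![s]

end ForkDiv

/-! A circular order cut at one of its points becomes a dense linear order with a least and no
greatest element, so cuts between finitely many points of a fibre can be filled exactly as in a
dense linear order. Hence a finite partial matching between two models that respects the basic
relations of `Sim` extends to any further element: a set fills a cut of `<`, and a point is added
after its fibre (`Sim.exists_extension`). By back-and-forth, the basic relations of a tuple decide
all its formulas (`Sim.formula_realize_iff`). A finite tuple has only finitely many of them, all
quantifier-free, which gives quantifier elimination; the empty tuple gives completeness.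

For dependence, a shattered sequence has no subsequence along which all truth values converge.
Convergence survives Boolean combinations, so atomic formulas suffice. These reduce to unary
relations and to binary relations that are strict weak orders on fibres, where a Ramsey argument
applies; cutting every fibre at a chosen base point makes the circular relation such a combination.

A countably indexed ultrapower is `ℵ₁`-saturated, and a countable elementary substructure of it
supplies the pair in (ii).

For forking, let `s` be a set outside `M`. Since `M` is closed under `f`, no point of `M` lies over
`s`, so any two pairs of distinct points of this fibre have the same type over `M ∪ {s}`
(`IsFibred.sim_of_fibre`). An infinite family of disjoint half-open arcs shows that each half-open
arc divides, and two such arcs cover the fibre. So the fibre formula forks. It does not divide,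
because its parameter belongs to the base. The type of any point over `s` contains it, so `M ∪ {s}`
is not an extension base. -/

namespace ForkDiv

open FirstOrder.Language

/-! ### The theory in semantic form -/

section Semantics

variable {M : Type u} [Lang.Structure M]

/-- `x` lies in the sort of points. -/
def Pt (x : M) : Prop := Structure.RelMap (L := Lang) Rel.point ![x]

/-- The order on the sort of sets. -/
def Lt (x y : M) : Prop := Structure.RelMap (L := Lang) Rel.lt ![x, y]

/-- The circular orders on the fibres. -/
def Circ (x y z s : M) : Prop := Structure.RelMap (L := Lang) Rel.circ ![x, y, z, s]

/-- The (totalized) map from points to sets. -/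
def fib (x : M) : M := Structure.funMap (L := Lang) Func.f ![x]

variable {α : Type} {n : ℕ} {v : α → M} {xs : Fin n → M}

theorem realize_fT {β : Type} (t : Lang.Term β) (w : β → M) :
    (fT t).realize w = fib (t.realize w) :=
  Term.realize_functions_apply₁

theorem realize_isPoint (t : Lang.Term (α ⊕ Fin n)) :
    (isPoint t).Realize v xs ↔ Pt (t.realize (Sum.elim v xs)) :=
  BoundedFormula.realize_rel₁

theorem realize_isSet (t : Lang.Term (α ⊕ Fin n)) :
    (isSet t).Realize v xs ↔ InSets (t.realize (Sum.elim v xs)) :=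
  BoundedFormula.realize_rel₁

theorem realize_lessThan (t₁ t₂ : Lang.Term (α ⊕ Fin n)) :
    (lessThan t₁ t₂).Realize v xs ↔
      Lt (t₁.realize (Sum.elim v xs)) (t₂.realize (Sum.elim v xs)) :=
  BoundedFormula.realize_rel₂

theorem realize_circ (t₁ t₂ t₃ s : Lang.Term (α ⊕ Fin n)) :
    (circ t₁ t₂ t₃ s).Realize v xs ↔
      Circ (t₁.realize (Sum.elim v xs)) (t₂.realize (Sum.elim v xs))
        (t₃.realize (Sum.elim v xs)) (s.realize (Sum.elim v xs)) := by
  rw [circ, BoundedFormula.realize_rel, Circ]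
  refine iff_of_eq (congrArg _ (funext fun i => ?_))
  fin_cases i <;> rfl

theorem realize_inFibre (t s : Lang.Term (α ⊕ Fin n)) :
    (inFibre t s).Realize v xs ↔
      Pt (t.realize (Sum.elim v xs)) ∧
        fib (t.realize (Sum.elim v xs)) = s.realize (Sum.elim v xs) := by
  simp [inFibre, realize_isPoint, realize_fT]

end Semantics

/-- The axioms of `fibreTheory`, as properties of a structure. -/
structure IsFibred (M : Type u) [Lang.Structure M] : Prop where
  pt_or (x : M) : Pt x ∨ InSets x
  not_pt {x : M} : InSets x → ¬ Pt x
  inSets_fib (x : M) : InSets (fib x)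
  fib_eq {x : M} : InSets x → fib x = x
  lt_inSets {x y : M} : Lt x y → InSets x ∧ InSets y
  lt_irrefl (x : M) : ¬ Lt x x
  lt_trans {x y z : M} : Lt x y → Lt y z → Lt x z
  lt_total {x y : M} : InSets x → InSets y → Lt x y ∨ x = y ∨ Lt y x
  lt_dense {x y : M} : Lt x y → ∃ z, Lt x z ∧ Lt z y
  exists_lt {x : M} : InSets x → ∃ y, Lt y x
  exists_gt {x : M} : InSets x → ∃ y, Lt x y
  circ_fib {x y z s : M} : Circ x y z s → (Pt x ∧ fib x = s) ∧ (Pt y ∧ fib y = s) ∧ Pt z ∧ fib z = s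
  circ_cyc {x y z s : M} : Circ x y z s → Circ y z x s
  circ_asymm {x y z s : M} : Circ x y z s → ¬ Circ z y x s
  circ_trans {x y z w s : M} : Circ x y z s → Circ x z w s → Circ x y w s
  circ_total {x y z s : M} : Pt x → fib x = s → Pt y → fib y = s → Pt z → fib z = s →
    x ≠ y → y ≠ z → x ≠ z → Circ x y z s ∨ Circ z y x s
  circ_dense {x y s : M} : Pt x → fib x = s → Pt y → fib y = s → x ≠ y → ∃ z, Circ x z y s
  exists_fib {s : M} : InSets s → ∀ (k : ℕ) (t : Fin k → M), ∃ x, Pt x ∧ fib x = s ∧ ∀ i, x ≠ t i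

section

variable {M : Type u} [Lang.Structure M]

theorem realize_infiniteFibre (k : ℕ) :
    M ⊨ infiniteFibre k ↔
      ∀ (s : M) (t : Fin k → M), InSets s → ∃ x, Pt x ∧ fib x = s ∧ ∀ i, x ≠ t i := by
  rw [infiniteFibre, Sentence.Realize, BoundedFormula.realize_alls]
  simp only [BoundedFormula.realize_imp, realize_isSet, BoundedFormula.realize_ex,
    BoundedFormula.realize_inf, realize_inFibre, BoundedFormula.realize_iInf,
    BoundedFormula.realize_not, BoundedFormula.realize_bdEqual, Term.realize_var, Sum.elim_inr,
    Fin.snoc_last, Fin.snoc_castSucc, and_assoc]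
  have h0 (xs : Fin (k + 1) → M) (x : M) : (Fin.snoc xs x : Fin (k + 2) → M) 0 = xs 0 :=
    Fin.snoc_castSucc (α := fun _ => M) x xs 0
  simp only [h0]
  refine ⟨fun h s t hs => by simpa using h (Fin.cons s t) hs, fun h xs hs => ?_⟩
  exact h (xs 0) (fun i => xs i.succ) hs

theorem model_iff_isFibred : M ⊨ fibreTheory ↔ IsFibred M := by
  simp only [fibreTheory, sortAxioms, orderAxioms, circularAxioms, Theory.model_iff, Set.mem_union,
    Set.mem_insert_iff, Set.mem_singleton_iff, or_imp, forall_and, forall_eq, Set.mem_range,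
    forall_exists_index, forall_apply_eq_imp_iff, realize_infiniteFibre]
  simp only [Sentence.Realize, Formula.Realize, BoundedFormula.realize_all,
    BoundedFormula.realize_imp, BoundedFormula.realize_ex, BoundedFormula.realize_inf,
    BoundedFormula.realize_sup, BoundedFormula.realize_not, BoundedFormula.realize_bdEqual,
    realize_isPoint, realize_isSet, realize_lessThan, realize_circ, realize_inFibre, realize_fT,
    Function.comp_apply, Term.realize_var, Sum.elim_inr]
  constructor
  · rintro ⟨⟨⟨⟨h1, h2, h3⟩, h4, h5, h6, h7, h8, h9, h10⟩, h11, h12, h13, h14, h15, h16⟩, h17⟩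
    exact
      { pt_or := fun x => (h1 x).1
        not_pt := fun hs hp => (h1 _).2 ⟨hp, hs⟩
        inSets_fib := h2
        fib_eq := h3 _
        lt_inSets := h4 _ _
        lt_irrefl := h5
        lt_trans := fun h h' => h6 _ _ _ ⟨h, h'⟩
        lt_total := fun h h' => h7 _ _ ⟨h, h'⟩
        lt_dense := h8 _ _
        exists_lt := h9 _
        exists_gt := h10 _
        circ_fib := h11 _ _ _ _
        circ_cyc := h12 _ _ _ _
        circ_asymm := h13 _ _ _ _
        circ_trans := fun h h' => h14 _ _ _ _ _ ⟨h, h'⟩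
        circ_total := fun a b c d e f g h i => h15 _ _ _ _ ⟨⟨a, b⟩, ⟨c, d⟩, ⟨e, f⟩⟩ ⟨g, h, i⟩
        circ_dense := fun a b c d e => h16 _ _ _ ⟨⟨a, b⟩, ⟨c, d⟩⟩ e
        exists_fib := fun hs k t => h17 k _ t hs }
  · intro h
    exact ⟨⟨⟨⟨fun x => ⟨h.pt_or x, fun hx => h.not_pt hx.2 hx.1⟩, h.inSets_fib, fun _ => h.fib_eq⟩,
      fun _ _ => h.lt_inSets, h.lt_irrefl, fun _ _ _ hx => h.lt_trans hx.1 hx.2,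
      fun _ _ hx => h.lt_total hx.1 hx.2, fun _ _ => h.lt_dense, fun _ => h.exists_lt,
      fun _ => h.exists_gt⟩,
      fun _ _ _ _ => h.circ_fib, fun _ _ _ _ => h.circ_cyc, fun _ _ _ _ => h.circ_asymm,
      fun _ _ _ _ _ hx => h.circ_trans hx.1 hx.2,
      fun _ _ _ _ hx hn => h.circ_total hx.1.1 hx.1.2 hx.2.1.1 hx.2.1.2 hx.2.2.1 hx.2.2.2
        hn.1 hn.2.1 hn.2.2,
      fun _ _ _ hx => h.circ_dense hx.1.1 hx.1.2 hx.2.1 hx.2.2⟩,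
      fun k s t hs => h.exists_fib hs k t⟩

end

end ForkDiv

/-! ### Cuts in dense linear orders -/

/-- Totality is asked only on `s` because the orders used below are linear only on a subset of the
structure: the sets, or one fibre. -/
theorem exists_greatest_of_total {α : Type*} {r : α → α → Prop}
    (htr : ∀ {x y z}, r x y → r y z → r x z) {s : Set α} (hs : s.Finite) (hne : s.Nonempty)
    (htot : ∀ x ∈ s, ∀ y ∈ s, r x y ∨ x = y ∨ r y x) : ∃ a ∈ s, ∀ x ∈ s, x = a ∨ r x a := by
  induction s, hs using Set.Finite.induction_on with
  | empty => exact absurd hne (by simp)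
  | @insert a s ha hs ih =>
    rcases s.eq_empty_or_nonempty with rfl | hne'
    · exact ⟨a, by simp, by simp⟩
    obtain ⟨b, hb, hmax⟩ := ih hne' fun x hx y hy => htot x (.inr hx) y (.inr hy)
    rcases htot a (.inl rfl) b (.inr hb) with h | h | h
    · exact ⟨b, .inr hb, by rintro x (rfl | hx); exacts [.inr h, hmax x hx]⟩
    · exact ⟨b, .inr hb, by rintro x (rfl | hx); exacts [.inl h, hmax x hx]⟩
    · refine ⟨a, .inl rfl, ?_⟩
      rintro x (rfl | hx)
      · exact .inl rfl
      · rcases hmax x hx with rfl | hx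
        exacts [.inr h, .inr (htr hx h)]

/-- A dense linear order `r` on `X` without greatest element realizes every finite cut `(lo, hi)`,
provided that `lo` is nonempty or that there is no least element. -/
theorem exists_cut {α : Type*} {r : α → α → Prop} {X : Set α}
    (htr : ∀ {x y z}, r x y → r y z → r x z)
    (hX : ∀ {x y}, r x y → x ∈ X ∧ y ∈ X)
    (htot : ∀ x ∈ X, ∀ y ∈ X, r x y ∨ x = y ∨ r y x)
    (hd : ∀ {x y}, r x y → ∃ z, r x z ∧ r z y)
    (hne : X.Nonempty) (hmax : ∀ x ∈ X, ∃ y, r x y) {lo hi : Set α}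
    (hmin : lo.Nonempty ∨ ∀ x ∈ X, ∃ y, r y x)
    (hlo : lo.Finite) (hhi : hi.Finite) (hloX : lo ⊆ X) (hhiX : hi ⊆ X)
    (hlt : ∀ x ∈ lo, ∀ y ∈ hi, r x y) :
    ∃ m ∈ X, (∀ x ∈ lo, r x m) ∧ ∀ y ∈ hi, r m y := by
  -- Only the greatest element of `lo` and the least element of `hi` matter; if one side is empty,
  -- unboundedness replaces density.
  have hgr : lo.Nonempty → ∃ a ∈ lo, ∀ x ∈ lo, x = a ∨ r x a := fun h =>
    exists_greatest_of_total (r := r) htr hlo h fun x hx y hy => htot x (hloX hx) y (hloX hy)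
  have hle : hi.Nonempty → ∃ a ∈ hi, ∀ x ∈ hi, x = a ∨ r a x := fun h =>
    exists_greatest_of_total (r := fun x y => r y x) (fun h h' => htr h' h) hhi h
      fun x hx y hy => (htot x (hhiX hx) y (hhiX hy)).elim (.inr ∘ .inr)
        fun h => h.elim (.inr ∘ .inl) .inl
  have low {a m} (ha : ∀ x ∈ lo, x = a ∨ r x a) (ham : r a m) : ∀ x ∈ lo, r x m := fun x hx => by
    rcases ha x hx with rfl | h
    exacts [ham, htr h ham]
  have high {b m} (hb : ∀ x ∈ hi, x = b ∨ r b x) (hmb : r m b) : ∀ x ∈ hi, r m x := fun x hx => by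
    rcases hb x hx with rfl | h
    exacts [hmb, htr hmb h]
  rcases lo.eq_empty_or_nonempty with rfl | hlne
  · rcases hi.eq_empty_or_nonempty with rfl | hhne
    · obtain ⟨m, hm⟩ := hne
      exact ⟨m, hm, by simp, by simp⟩
    · obtain ⟨b, hb, hb'⟩ := hle hhne
      obtain ⟨m, hm⟩ := (hmin.resolve_left (by simp)) b (hhiX hb)
      exact ⟨m, (hX hm).1, by simp, high hb' hm⟩
  · obtain ⟨a, ha, ha'⟩ := hgr hlne
    rcases hi.eq_empty_or_nonempty with rfl | hhne
    · obtain ⟨m, hm⟩ := hmax a (hloX ha)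
      exact ⟨m, (hX hm).2, low ha' hm, by simp⟩
    · obtain ⟨b, hb, hb'⟩ := hle hhne
      obtain ⟨m, ham, hmb⟩ := hd (hlt a ha b hb)
      exact ⟨m, (hX ham).2, low ha' ham, high hb' hmb⟩

namespace ForkDiv

open FirstOrder.Language

variable {M N : Type u} [Lang.Structure M] [Lang.Structure N]

/-! ### Circular orders cut at a point -/

/-- The linear order with least element `b` obtained by cutting the circular order on the fibre
of `b` at the point `b`. -/
def CutLt (b x y : M) : Prop :=
  (Pt x ∧ fib x = fib b) ∧ (Pt y ∧ fib y = fib b) ∧ x ≠ y ∧ (x = b ∨ Circ b x y (fib b))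

namespace IsFibred

variable (h : IsFibred M) {b x y z s : M}
include h

theorem circ_ne (hc : Circ x y z s) : x ≠ y ∧ y ≠ z ∧ x ≠ z := by
  have key : ∀ {x z : M}, ¬ Circ x x z s := fun hc => h.circ_asymm (h.circ_cyc hc) (h.circ_cyc hc)
  refine ⟨?_, ?_, ?_⟩ <;> rintro rfl
  · exact key hc
  · exact key (h.circ_cyc hc)
  · exact key (h.circ_cyc (h.circ_cyc hc))

theorem not_pt_iff : ¬ Pt x ↔ InSets x := ⟨(h.pt_or x).resolve_left, h.not_pt⟩

theorem cutLt_trans (h₁ : CutLt b x y) (h₂ : CutLt b y z) : CutLt b x z := by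
  obtain ⟨hx, hy, hxy, h₁⟩ := h₁
  obtain ⟨-, hz, hyz, h₂⟩ := h₂
  rcases h₁ with rfl | h₁
  · rcases h₂ with rfl | h₂
    · exact absurd rfl hxy
    · exact ⟨hx, hz, (h.circ_ne h₂).2.2, .inl rfl⟩
  · rcases h₂ with rfl | h₂
    · exact absurd rfl (h.circ_ne h₁).2.2
    · have h₃ := h.circ_trans h₁ h₂
      exact ⟨hx, hz, (h.circ_ne h₃).2.1, .inr h₃⟩

theorem cutLt_asymm (h₁ : CutLt b x y) : ¬ CutLt b y x :=
  fun h₂ => (h.cutLt_trans h₁ h₂).2.2.1 rfl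

theorem cutLt_total (hb : Pt b) (hx : Pt x ∧ fib x = fib b) (hy : Pt y ∧ fib y = fib b) :
    CutLt b x y ∨ x = y ∨ CutLt b y x := by
  by_cases hxy : x = y
  · exact .inr (.inl hxy)
  by_cases hxb : x = b
  · exact .inl ⟨hx, hy, hxy, .inl hxb⟩
  by_cases hyb : y = b
  · exact .inr (.inr ⟨hy, hx, Ne.symm hxy, .inl hyb⟩)
  rcases h.circ_total hb rfl hx.1 hx.2 hy.1 hy.2 (Ne.symm hxb) hxy (Ne.symm hyb) with hc | hc
  · exact .inl ⟨hx, hy, hxy, .inr hc⟩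
  · exact .inr (.inr ⟨hy, hx, Ne.symm hxy, .inr (h.circ_cyc (h.circ_cyc hc))⟩)

/-- If `b` is not among the points, rotate to `C(y,z,b)` and `C(y,b,x)` and use transitivity at `y`;
a minimal `x` may be `b` itself, while `y = b` is impossible. -/
theorem circ_of_cutLt (hs : fib b = s) (h₁ : CutLt b x y) (h₂ : CutLt b y z) : Circ x y z s := by
  subst hs
  rcases h₂.2.2.2 with rfl | h₂
  · rcases h₁.2.2.2 with rfl | h₁'
    · exact absurd rfl h₁.2.2.1
    · exact absurd rfl (h.circ_ne h₁').2.2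
  · rcases h₁.2.2.2 with rfl | h₁
    · exact h₂
    · exact h.circ_cyc (h.circ_cyc (h.circ_trans (h.circ_cyc h₂) (h.circ_cyc (h.circ_cyc h₁))))

/-- The circular order is recovered from its cut: a positive triple is increasing up to rotation.
This reduces extension problems in a fibre to linear cuts. -/
theorem circ_iff_cutLt (hb : Pt b) (hs : fib b = s) :
    Circ x y z s ↔ (CutLt b x y ∧ CutLt b y z) ∨ (CutLt b y z ∧ CutLt b z x) ∨
      (CutLt b z x ∧ CutLt b x y) := by
  constructor
  · intro hc
    obtain ⟨hx, hy, hz⟩ := h.circ_fib hc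
    obtain ⟨hxy, hyz, hxz⟩ := h.circ_ne hc
    -- A decreasing triple would reverse the orientation; applied to the three rotations of `hc`,
    -- this removes the wrong cases.
    have hn {p q r} (hc' : Circ p q r s) (h₁ : CutLt b r q) (h₂ : CutLt b q p) : False :=
      h.circ_asymm hc' (h.circ_of_cutLt hs h₁ h₂)
    subst hs
    have hc₂ := h.circ_cyc hc
    have hc₃ := h.circ_cyc hc₂
    rcases h.cutLt_total hb hx hy with h₁ | h₁ | h₁ <;>
    rcases h.cutLt_total hb hy hz with h₂ | h₂ | h₂ <;>
    rcases h.cutLt_total hb hz hx with h₃ | h₃ | h₃ <;> grind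
  · rintro (⟨h₁, h₂⟩ | ⟨h₁, h₂⟩ | ⟨h₁, h₂⟩)
    · exact h.circ_of_cutLt hs h₁ h₂
    · exact h.circ_cyc (h.circ_cyc (h.circ_of_cutLt hs h₁ h₂))
    · exact h.circ_cyc (h.circ_of_cutLt hs h₁ h₂)

theorem cutLt_dense (hxy : CutLt b x y) : ∃ z, CutLt b x z ∧ CutLt b z y := by
  obtain ⟨hx, hy, hne, h₁⟩ := hxy
  obtain ⟨z, hz⟩ := h.circ_dense hx.1 hx.2 hy.1 hy.2 hne
  obtain ⟨hxz, hzy, -⟩ := h.circ_ne hz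
  have hz' := (h.circ_fib hz).2.1
  rcases h₁ with rfl | h₁
  · exact ⟨z, ⟨hx, hz', hxz, .inl rfl⟩, hz', hy, hzy, .inr hz⟩
  · refine ⟨z, ⟨hx, hz', hxz, .inr ?_⟩, hz', hy, hzy, .inr ?_⟩
    · exact h.circ_cyc (h.circ_cyc (h.circ_trans hz (h.circ_cyc h₁)))
    · have h₂ := h.circ_cyc (h.circ_cyc hz)
      have h₃ := h.circ_cyc (h.circ_cyc h₁)
      exact h.circ_cyc (h.circ_trans h₃ h₂)

theorem cutLt_exists_gt (hb : Pt b) (hx : Pt x ∧ fib x = fib b) : ∃ y, CutLt b x y := by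
  by_cases hxb : x = b
  · obtain ⟨y, hy, hfy, hne⟩ := h.exists_fib (h.inSets_fib b) 1 fun _ => b
    exact ⟨y, hx, ⟨hy, hfy⟩, fun e => hne 0 (e ▸ hxb), .inl hxb⟩
  -- A point on the arc from `x` back round to `b` lies above `x` in the cut order.
  · obtain ⟨y, hy⟩ := h.circ_dense hx.1 hx.2 hb rfl hxb
    exact ⟨y, hx, (h.circ_fib hy).2.1, (h.circ_ne hy).1, .inr (h.circ_cyc (h.circ_cyc hy))⟩

theorem exists_cutLt_cut (hb : Pt b) {lo hi : Set M} (hlo : lo.Finite) (hhi : hi.Finite)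
    (hne : lo.Nonempty) (hloX : ∀ x ∈ lo, Pt x ∧ fib x = fib b)
    (hhiX : ∀ x ∈ hi, Pt x ∧ fib x = fib b) (hlt : ∀ x ∈ lo, ∀ y ∈ hi, CutLt b x y) :
    ∃ m, (Pt m ∧ fib m = fib b) ∧ (∀ x ∈ lo, CutLt b x m) ∧ ∀ y ∈ hi, CutLt b m y :=
  exists_cut (r := CutLt b) (X := {x | Pt x ∧ fib x = fib b}) h.cutLt_trans
    (fun h => ⟨h.1, h.2.1⟩)
    (fun _ hx _ hy => h.cutLt_total hb hx hy) h.cutLt_dense ⟨b, hb, rfl⟩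
    (fun _ hx => h.cutLt_exists_gt hb hx) (.inl hne) hlo hhi hloX hhiX hlt

theorem exists_lt_cut [Nonempty M] {lo hi : Set M} (hlo : lo.Finite) (hhi : hi.Finite)
    (hloX : ∀ x ∈ lo, InSets x) (hhiX : ∀ x ∈ hi, InSets x) (hlt : ∀ x ∈ lo, ∀ y ∈ hi, Lt x y) :
    ∃ m, InSets m ∧ (∀ x ∈ lo, Lt x m) ∧ ∀ y ∈ hi, Lt m y :=
  exists_cut (r := Lt) (X := {x | InSets x}) h.lt_trans h.lt_inSets
    (fun _ hx _ hy => h.lt_total hx hy) h.lt_dense ⟨_, h.inSets_fib (Classical.arbitrary M)⟩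
    (fun _ => h.exists_gt) (.inr fun _ => h.exists_lt) hlo hhi hloX hhiX hlt

end IsFibred

end ForkDiv

namespace ForkDiv

open FirstOrder.Language

/-! ### Back-and-forth between models -/

section

variable {M N : Type u} [Lang.Structure M] [Lang.Structure N]

/-- The tuples `v` and `w` satisfy the same basic relations. -/
structure Sim {ι : Type*} (v : ι → M) (w : ι → N) : Prop where
  pt_iff (i : ι) : Pt (v i) ↔ Pt (w i)
  eq_iff (i j : ι) : v i = v j ↔ w i = w j
  fib_iff (i j : ι) : fib (v i) = fib (v j) ↔ fib (w i) = fib (w j)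
  lt_iff (i j : ι) : Lt (fib (v i)) (fib (v j)) ↔ Lt (fib (w i)) (fib (w j))
  circ_iff (i j k : ι) : Circ (v i) (v j) (v k) (fib (v i)) ↔
    Circ (w i) (w j) (w k) (fib (w i))

namespace IsFibred

variable (h : IsFibred M)
include h

theorem fib_fib (x : M) : fib (fib x) = fib x := h.fib_eq (h.inSets_fib x)

theorem not_pt_fib (x : M) : ¬ Pt (fib x) := h.not_pt (h.inSets_fib x)

/-- Together with `lt_iff` and `circ_iff`, this normal form reduces atomic formulas to the relations
recorded by `Sim`, which compare sets only as fibres of elements. -/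
theorem eq_fib_iff (x y : M) : x = fib y ↔ ¬ Pt x ∧ fib x = fib y := by
  constructor
  · rintro rfl
    exact ⟨h.not_pt_fib y, h.fib_fib y⟩
  · rintro ⟨hx, hxy⟩
    rw [← hxy, h.fib_eq (h.not_pt_iff.1 hx)]

theorem lt_iff (x y : M) : Lt x y ↔ ¬ Pt x ∧ ¬ Pt y ∧ Lt (fib x) (fib y) := by
  constructor
  · intro hxy
    obtain ⟨hx, hy⟩ := h.lt_inSets hxy
    exact ⟨h.not_pt hx, h.not_pt hy, by rwa [h.fib_eq hx, h.fib_eq hy]⟩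
  · rintro ⟨hx, hy, hxy⟩
    rwa [h.fib_eq (h.not_pt_iff.1 hx), h.fib_eq (h.not_pt_iff.1 hy)] at hxy

theorem circ_iff (x y z s : M) : Circ x y z s ↔ Circ x y z (fib x) ∧ fib x = s := by
  constructor
  · intro hc
    obtain rfl := (h.circ_fib hc).1.2
    exact ⟨hc, rfl⟩
  · rintro ⟨hc, rfl⟩
    exact hc

theorem circ_rotate (x y z : M) : Circ x y z (fib x) ↔ Circ y z x (fib y) := by
  have key {x y z : M} (hc : Circ x y z (fib x)) : Circ y z x (fib y) := by
    rw [(h.circ_fib hc).2.1.2]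
    exact h.circ_cyc hc
  exact ⟨key, fun hc => key (key hc)⟩

end IsFibred

namespace Sim

variable {ι : Type*} {v : ι → M} {w : ι → N}

theorem symm (hs : Sim v w) : Sim w v :=
  ⟨fun i => (hs.pt_iff i).symm, fun i j => (hs.eq_iff i j).symm, fun i j => (hs.fib_iff i j).symm,
    fun i j => (hs.lt_iff i j).symm, fun i j k => (hs.circ_iff i j k).symm⟩

theorem comp {κ : Type*} (hs : Sim v w) (e : κ → ι) : Sim (v ∘ e) (w ∘ e) :=
  ⟨fun i => hs.pt_iff (e i), fun i j => hs.eq_iff (e i) (e j), fun i j => hs.fib_iff (e i) (e j),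
    fun i j => hs.lt_iff (e i) (e j), fun i j k => hs.circ_iff (e i) (e j) (e k)⟩

theorem cutLt (hs : Sim v w) (i j k : ι) :
    CutLt (v i) (v j) (v k) ↔ CutLt (w i) (w j) (w k) := by
  simp only [CutLt, hs.pt_iff, hs.fib_iff, hs.eq_iff, hs.circ_iff, ne_eq]

variable (hM : IsFibred M) (hN : IsFibred N)
include hM hN

/-- Adjoining to a tuple the images under `fib` of its members. -/
theorem adjoin_fib (hs : Sim v w) : Sim (Sum.elim v (fib ∘ v)) (Sum.elim w (fib ∘ w)) := by
  refine ⟨?_, ?_, ?_, ?_, ?_⟩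
  · rintro (i | i) <;> simp [hs.pt_iff, hM.not_pt_fib, hN.not_pt_fib]
  · have key (i j : ι) : v i = fib (v j) ↔ w i = fib (w j) := by
      rw [hM.eq_fib_iff, hN.eq_fib_iff, hs.pt_iff, hs.fib_iff]
    rintro (i | i) (j | j)
    exacts [hs.eq_iff i j, key i j, eq_comm.trans ((key j i).trans eq_comm), hs.fib_iff i j]
  · rintro (i | i) (j | j) <;> simp [hM.fib_fib, hN.fib_fib, hs.fib_iff]
  · rintro (i | i) (j | j) <;> simp [hM.fib_fib, hN.fib_fib, hs.lt_iff]
  · have hM' {x y z s : M} (hn : ¬ (Pt x ∧ Pt y ∧ Pt z)) : ¬ Circ x y z s := fun hc =>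
      hn ⟨(hM.circ_fib hc).1.1, (hM.circ_fib hc).2.1.1, (hM.circ_fib hc).2.2.1⟩
    have hN' {x y z s : N} (hn : ¬ (Pt x ∧ Pt y ∧ Pt z)) : ¬ Circ x y z s := fun hc =>
      hn ⟨(hN.circ_fib hc).1.1, (hN.circ_fib hc).2.1.1, (hN.circ_fib hc).2.2.1⟩
    rintro (i | i) (j | j) (k | k)
    · simp [hs.circ_iff]
    all_goals
      exact iff_of_false (hM' (by simp [hM.not_pt_fib])) (hN' (by simp [hN.not_pt_fib]))

/-- Circular triples are checked only with the new element in first place: rotation gives the other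
places, and a repeated entry makes both sides false. -/
theorem option (hs : Sim v w) {c : M} {d : N} (hpt : Pt c ↔ Pt d) (heq : ∀ i, v i = c ↔ w i = d)
    (hfib : ∀ i, fib (v i) = fib c ↔ fib (w i) = fib d)
    (hlt : ∀ i, Lt (fib (v i)) (fib c) ↔ Lt (fib (w i)) (fib d))
    (hgt : ∀ i, Lt (fib c) (fib (v i)) ↔ Lt (fib d) (fib (w i)))
    (hcirc : ∀ i j, Circ c (v i) (v j) (fib c) ↔ Circ d (w i) (w j) (fib d)) :
    Sim (fun o : Option ι => o.elim c v) (fun o : Option ι => o.elim d w) := by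
  refine ⟨?_, ?_, ?_, ?_, ?_⟩
  · rintro (_ | i) <;> simp [hs.pt_iff, hpt]
  · rintro (_ | i) (_ | j) <;>
      simp [hs.eq_iff, heq, eq_comm (a := c), eq_comm (a := d)]
  · rintro (_ | i) (_ | j) <;>
      simp [hs.fib_iff, hfib, eq_comm (a := fib c), eq_comm (a := fib d)]
  · rintro (_ | i) (_ | j) <;> simp [hs.lt_iff, hlt, hgt, hM.lt_irrefl, hN.lt_irrefl]
  · rintro (_ | i) (_ | j) (_ | k) <;> simp only [Option.elim]
    · exact iff_of_false (fun hc => (hM.circ_ne hc).1 rfl) (fun hc => (hN.circ_ne hc).1 rfl)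
    · exact iff_of_false (fun hc => (hM.circ_ne hc).1 rfl) (fun hc => (hN.circ_ne hc).1 rfl)
    · exact iff_of_false (fun hc => (hM.circ_ne hc).2.2 rfl) (fun hc => (hN.circ_ne hc).2.2 rfl)
    · exact hcirc j k
    · exact iff_of_false (fun hc => (hM.circ_ne hc).2.1 rfl) (fun hc => (hN.circ_ne hc).2.1 rfl)
    · rw [hM.circ_rotate, hN.circ_rotate]
      exact hcirc k i
    · rw [← hM.circ_rotate, ← hN.circ_rotate]
      exact hcirc i j
    · exact hs.circ_iff i j k

theorem exists_of_inSets [Nonempty N] [Finite ι] (hs : Sim v w) {c : M} (hc : InSets c) :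
    ∃ d : N, Sim (fun o : Option ι => o.elim c v) (fun o : Option ι => o.elim d w) := by
  by_cases hi : ∃ i, fib (v i) = c
  · obtain ⟨i, rfl⟩ := hi
    refine ⟨fib (w i), ?_⟩
    have := (hs.adjoin_fib hM hN).comp fun o : Option ι => o.elim (.inr i) .inl
    refine iff_of_eq ?_ |>.1 this
    congr 1 <;> ext o <;> cases o <;> rfl
  -- The new set differs from all fibres in the tuple, so it is determined by its cut among them.
  · push Not at hi
    have hcM := hM.not_pt hc
    have hcf := hM.fib_eq hc
    obtain ⟨d, hd, hlo, hhi⟩ := hN.exists_lt_cut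
      (lo := (fun i => fib (w i)) '' {i | Lt (fib (v i)) c})
      (hi := (fun i => fib (w i)) '' {i | Lt c (fib (v i))})
      (Set.toFinite _) (Set.toFinite _)
      (by rintro _ ⟨i, -, rfl⟩; exact hN.inSets_fib _)
      (by rintro _ ⟨i, -, rfl⟩; exact hN.inSets_fib _)
      (by
        rintro _ ⟨i, hi, rfl⟩ _ ⟨j, hj, rfl⟩
        exact (hs.lt_iff i j).1 (hM.lt_trans hi hj))
    have hdN := hN.not_pt hd
    have hdf := hN.fib_eq hd
    have hlo' : ∀ i, Lt (fib (v i)) c → Lt (fib (w i)) d :=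
      fun i hi => hlo _ ⟨i, hi, rfl⟩
    have hhi' : ∀ i, Lt c (fib (v i)) → Lt d (fib (w i)) :=
      fun i hi => hhi _ ⟨i, hi, rfl⟩
    have htot : ∀ i, Lt (fib (v i)) c ∨ Lt c (fib (v i)) := fun i => by
      rcases hM.lt_total (hM.inSets_fib (v i)) hc with h | h | h
      exacts [.inl h, absurd h (hi i), .inr h]
    have hasymm : ∀ {x y : N}, Lt x y → ¬ Lt y x := fun h h' => hN.lt_irrefl _ (hN.lt_trans h h')
    have hne : ∀ i, fib (w i) ≠ d := fun i e => by
      rcases htot i with h | h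
      · exact hN.lt_irrefl d (by simpa [e] using hlo' i h)
      · exact hN.lt_irrefl d (by simpa [e] using hhi' i h)
    refine ⟨d, hs.option hM hN (iff_of_false hcM hdN) (fun i => iff_of_false ?_ ?_)
      (fun i => ?_) (fun i => ?_) (fun i => ?_) fun i j => ?_⟩
    · rintro rfl
      exact hi i hcf
    · rintro rfl
      exact hne i hdf
    · rw [hcf, hdf]
      exact iff_of_false (hi i) (hne i)
    · rw [hcf, hdf]
      refine ⟨hlo' i, fun h => (htot i).resolve_right fun h' => hasymm h (hhi' i h')⟩
    · rw [hcf, hdf]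
      refine ⟨hhi' i, fun h => (htot i).resolve_left fun h' => hasymm h (hlo' i h')⟩
    · exact iff_of_false (fun h => hcM (hM.circ_fib h).1.1) (fun h => hdN (hN.circ_fib h).1.1)

/-- Since the fibre of `c` is already named by `v i₀`, the fibre of `d` is forced and only the
position inside it is left to choose. -/
theorem exists_of_pt [Finite ι] (hs : Sim v w) {c : M} (hc : Pt c) (i₀ : ι)
    (hi₀ : v i₀ = fib c) :
    ∃ d : N, Sim (fun o : Option ι => o.elim c v) (fun o : Option ι => o.elim d w) := by
  by_cases hi : ∃ i, v i = c
  · obtain ⟨i, rfl⟩ := hi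
    refine ⟨w i, ?_⟩
    have := hs.comp fun o : Option ι => o.elim i id
    refine iff_of_eq ?_ |>.1 this
    congr 1 <;> ext o <;> cases o <;> rfl
  push Not at hi
  have hv₀ : fib (v i₀) = fib c := by rw [hi₀, hM.fib_fib]
  suffices H : ∃ d : N, Pt d ∧ fib d = fib (w i₀) ∧ (∀ i, w i ≠ d) ∧
      ∀ i j, Circ c (v i) (v j) (fib c) ↔ Circ d (w i) (w j) (fib d) by
    obtain ⟨d, hd, hdf, hne, hcirc⟩ := H
    refine ⟨d, hs.option hM hN (iff_of_true hc hd) (fun i => iff_of_false (hi i) (hne i))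
      (fun i => ?_) (fun i => ?_) (fun i => ?_) hcirc⟩
    · rw [← hv₀, hdf, hs.fib_iff]
    · rw [← hv₀, hdf, hs.lt_iff]
    · rw [← hv₀, hdf, hs.lt_iff]
  have hmem : ∀ i, (Pt (v i) ∧ fib (v i) = fib c) ↔
      (Pt (w i) ∧ fib (w i) = fib (w i₀)) := fun i => by
    rw [← hv₀, hs.pt_iff, hs.fib_iff]
  -- A point `v b` of the tuple in this fibre serves as the place to cut; without one, any point of
  -- the fibre avoiding the tuple will do.
  by_cases hJ : ∃ j, Pt (v j) ∧ fib (v j) = fib c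
  · obtain ⟨b, hb, hbf⟩ := hJ
    obtain ⟨hb', hbf'⟩ := (hmem b).1 ⟨hb, hbf⟩
    have hcb : Pt c ∧ fib c = fib (v b) := ⟨hc, hbf.symm⟩
    obtain ⟨d, hd, hlo, hhi⟩ := hN.exists_cutLt_cut hb'
      (lo := w '' {i | CutLt (v b) (v i) c}) (hi := w '' {i | CutLt (v b) c (v i)})
      (Set.toFinite _) (Set.toFinite _)
      -- The cutting point is the least element, hence in the lower half, so the cut order need not
      -- be unbounded below.
      ⟨_, b, ⟨⟨hb, rfl⟩, hcb, hi b, .inl rfl⟩, rfl⟩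
      (by
        rintro _ ⟨i, hi, rfl⟩
        rw [← hs.pt_iff, ← hs.fib_iff]
        exact hi.1)
      (by
        rintro _ ⟨i, hi, rfl⟩
        rw [← hs.pt_iff, ← hs.fib_iff]
        exact hi.2.1)
      (by
        rintro _ ⟨i, hi, rfl⟩ _ ⟨j, hj, rfl⟩
        exact (hs.cutLt b i j).1 (hM.cutLt_trans hi hj))
    have hlo' : ∀ i, CutLt (v b) (v i) c → CutLt (w b) (w i) d := fun i hi => hlo _ ⟨i, hi, rfl⟩
    have hhi' : ∀ i, CutLt (v b) c (v i) → CutLt (w b) d (w i) := fun i hi => hhi _ ⟨i, hi, rfl⟩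
    have htot : ∀ i, Pt (w i) ∧ fib (w i) = fib (w b) →
        CutLt (v b) (v i) c ∨ CutLt (v b) c (v i) := fun i h => by
      rw [← hs.pt_iff, ← hs.fib_iff] at h
      rcases hM.cutLt_total hb h hcb with h | h | h
      exacts [.inl h, absurd h (hi i), .inr h]
    have hlo_iff : ∀ i, CutLt (v b) (v i) c ↔ CutLt (w b) (w i) d := fun i =>
      ⟨hlo' i, fun h => (htot i h.1).resolve_right fun h' => hN.cutLt_asymm h (hhi' i h')⟩
    have hhi_iff : ∀ i, CutLt (v b) c (v i) ↔ CutLt (w b) d (w i) := fun i =>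
      ⟨hhi' i, fun h => (htot i h.2.1).resolve_left fun h' => hN.cutLt_asymm h (hlo' i h')⟩
    refine ⟨d, hd.1, hd.2.trans hbf', ?_, fun i j => ?_⟩
    · rintro i rfl
      rcases htot i hd with h | h
      exacts [(hlo' i h).2.2.1 rfl, (hhi' i h).2.2.1 rfl]
    · rw [hM.circ_iff_cutLt hb hbf, hN.circ_iff_cutLt hb' hd.2.symm]
      simp only [hlo_iff, hhi_iff, hs.cutLt]
  · push Not at hJ
    obtain ⟨n, ⟨e⟩⟩ := Finite.exists_equiv_fin ι
    obtain ⟨d, hd, hdf, hne⟩ := hN.exists_fib (hN.inSets_fib (w i₀)) n (w ∘ e.symm)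
    refine ⟨d, hd, hdf, fun i h => hne (e i) (by simp [h]), fun i j => iff_of_false ?_ ?_⟩
    · intro h
      exact hJ i (hM.circ_fib h).2.1.1 (hM.circ_fib h).2.1.2
    · intro h
      have := (hmem i).2 ⟨(hN.circ_fib h).2.1.1, (hN.circ_fib h).2.1.2.trans hdf⟩
      exact hJ i this.1 this.2

/-- For a point, its fibre is adjoined first, then the point, and the auxiliary fibre is dropped. -/
theorem exists_extension [Nonempty N] [Finite ι] (hs : Sim v w) (c : M) :
    ∃ d : N, Sim (fun o : Option ι => o.elim c v) (fun o : Option ι => o.elim d w) := by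
  rcases hM.pt_or c with hc | hc
  · obtain ⟨t, ht⟩ := hs.exists_of_inSets hM hN (hM.inSets_fib c)
    obtain ⟨d, hd⟩ := ht.exists_of_pt hM hN hc none rfl
    refine ⟨d, ?_⟩
    have := hd.comp fun o : Option ι => o.elim none (some ∘ some)
    refine iff_of_eq ?_ |>.1 this
    congr 1 <;> ext o <;> cases o <;> rfl
  · exact hs.exists_of_inSets hM hN hc

end Sim

end

end ForkDiv

namespace ForkDiv

open FirstOrder.Language

/-! ### Elementary equivalence of similar tuples -/

/-- Over a fibred structure, every term denotes a variable or the image under `fib` of one. -/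
theorem exists_realize_eq {α : Type*} (t : Lang.Term α) :
    ∃ i : α ⊕ α, ∀ (M : Type u) [Lang.Structure M], IsFibred M → ∀ v : α → M,
      t.realize v = Sum.elim v (fib ∘ v) i := by
  induction t with
  | var a => exact ⟨.inl a, fun _ _ _ _ => rfl⟩
  | @func l g ts ih =>
    cases g
    have hf (M : Type u) [Lang.Structure M] (v : α → M) :
        (func Func.f ts : Lang.Term α).realize v = fib ((ts 0).realize v) := by
      rw [Term.realize, fib]
      congr 1
      funext j
      fin_cases j
      rfl
    obtain ⟨i | i, hi⟩ := ih 0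
    · exact ⟨.inr i, fun M _ hM v => by rw [hf, hi M hM]; rfl⟩
    · exact ⟨.inr i, fun M _ hM v => by rw [hf, hi M hM]; exact hM.fib_fib _⟩

section

variable {M N : Type u} [Lang.Structure M] [Lang.Structure N]

theorem relMap_point (x : Fin 1 → M) : Structure.RelMap (L := Lang) Rel.point x ↔ Pt (x 0) := by
  rw [Pt]
  exact iff_of_eq (congrArg _ (funext fun i => by fin_cases i; rfl))

theorem relMap_set (x : Fin 1 → M) : Structure.RelMap (L := Lang) Rel.set x ↔ InSets (x 0) := by
  rw [InSets]
  exact iff_of_eq (congrArg _ (funext fun i => by fin_cases i; rfl))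

theorem relMap_lt (x : Fin 2 → M) : Structure.RelMap (L := Lang) Rel.lt x ↔ Lt (x 0) (x 1) := by
  rw [Lt]
  exact iff_of_eq (congrArg _ (funext fun i => by fin_cases i <;> rfl))

theorem relMap_circ (x : Fin 4 → M) :
    Structure.RelMap (L := Lang) Rel.circ x ↔ Circ (x 0) (x 1) (x 2) (x 3) := by
  rw [Circ]
  exact iff_of_eq (congrArg _ (funext fun i => by fin_cases i <;> rfl))

namespace Sim

theorem realize_iff (hM : IsFibred M) (hN : IsFibred N) [Nonempty M] [Nonempty N] {α : Type*}
    [Finite α] {n : ℕ} (φ : Lang.BoundedFormula α n) {v : α → M} {w : α → N} {xs : Fin n → M}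
    {ys : Fin n → N} (hs : Sim (Sum.elim v xs) (Sum.elim w ys)) :
    φ.Realize v xs ↔ φ.Realize w ys := by
  induction φ with
  | falsum => rfl
  | equal t₁ t₂ =>
    obtain ⟨i, hi⟩ := exists_realize_eq.{u, _} t₁
    obtain ⟨j, hj⟩ := exists_realize_eq.{u, _} t₂
    simp only [BoundedFormula.Realize, hi M hM, hj M hM, hi N hN, hj N hN]
    exact (hs.adjoin_fib hM hN).eq_iff i j
  | rel R ts =>
    choose e he using fun k => exists_realize_eq.{u, _} (ts k)
    have hs' := (hs.adjoin_fib hM hN).comp e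
    simp only [BoundedFormula.Realize, fun k => he k M hM, fun k => he k N hN]
    cases R
    · rw [relMap_point, relMap_point]
      exact hs'.pt_iff 0
    · rw [relMap_set, relMap_set, ← hM.not_pt_iff, ← hN.not_pt_iff]
      exact not_congr (hs'.pt_iff 0)
    · rw [relMap_lt, relMap_lt, hM.lt_iff, hN.lt_iff]
      exact and_congr (not_congr (hs'.pt_iff 0))
        (and_congr (not_congr (hs'.pt_iff 1)) (hs'.lt_iff 0 1))
    · rw [relMap_circ, relMap_circ, hM.circ_iff, hN.circ_iff,
        eq_comm.trans (hM.eq_fib_iff _ _), eq_comm.trans (hN.eq_fib_iff _ _)]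
      exact and_congr (hs'.circ_iff 0 1 2) (and_congr (not_congr (hs'.pt_iff 3)) (hs'.fib_iff 3 0))
  | imp φ ψ ih₁ ih₂ => exact imp_congr (ih₁ hs) (ih₂ hs)
  | @all n φ ih =>
    -- Stated for arbitrary models so that it serves both the forth and the back direction.
    have step {M N : Type u} [Lang.Structure M] [Lang.Structure N] [Nonempty N]
        (hM : IsFibred M) (hN : IsFibred N) {v : α → M} {w : α → N} {xs : Fin n → M}
        {ys : Fin n → N} (hs : Sim (Sum.elim v xs) (Sum.elim w ys)) (x : M) :
        ∃ y : N, Sim (Sum.elim v (Fin.snoc xs x : Fin (n + 1) → M))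
          (Sum.elim w (Fin.snoc ys y : Fin (n + 1) → N)) := by
      obtain ⟨y, hy⟩ := hs.exists_extension hM hN x
      refine ⟨y, ?_⟩
      have := hy.comp (Sum.elim (fun a => some (.inl a))
        (Fin.lastCases none fun k => some (.inr k)) : α ⊕ Fin (n + 1) → Option (α ⊕ Fin n))
      refine iff_of_eq ?_ |>.1 this
      congr 1 <;>
      · ext (a | k)
        · rfl
        · refine Fin.lastCases ?_ (fun k => ?_) k <;> simp
    simp only [BoundedFormula.realize_all]
    constructor
    · intro h y
      obtain ⟨x, hx⟩ := step hN hM hs.symm y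
      exact (ih hx.symm).1 (h x)
    · intro h x
      obtain ⟨y, hy⟩ := step hM hN hs x
      exact (ih hy).2 (h y)

/-- A formula has finitely many free variables, so finiteness of the index type can be dropped. This
is what allows infinite parameter sets later. -/
theorem formula_realize_iff (hM : IsFibred M) (hN : IsFibred N) [Nonempty M] [Nonempty N]
    {α : Type*} (φ : Lang.Formula α) {v : α → M} {w : α → N} (hs : Sim v w) :
    φ.Realize v ↔ φ.Realize w := by
  classical
  have key := realize_iff hM hN (φ.restrictFreeVar id) (xs := default) (ys := default)
    (v := fun a : φ.freeVarFinset => v a) (w := fun a : φ.freeVarFinset => w a) <| by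
      have := hs.comp (Sum.elim (fun a : φ.freeVarFinset => a.1) Fin.elim0)
      refine iff_of_eq ?_ |>.1 this
      congr 1 <;>
      · ext (a | k)
        exacts [rfl, k.elim0]
  exact (BoundedFormula.realize_restrictFreeVar (f := id) v fun _ => rfl).symm.trans
    (key.trans (BoundedFormula.realize_restrictFreeVar (f := id) w fun _ => rfl))

end Sim

end

end ForkDiv

namespace ForkDiv

open FirstOrder.Language

/-! ### Quantifier elimination -/

section General

variable {L : FirstOrder.Language.{0, 0}} {α : Type} {n : ℕ}

theorem isQF_iInf {β : Type} [Finite β] {θ : β → L.BoundedFormula α n}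
    (h : ∀ b, (θ b).IsQF) : (BoundedFormula.iInf θ).IsQF := by
  have key : ∀ l : List (L.BoundedFormula α n), (∀ φ ∈ l, φ.IsQF) →
      (l.foldr (· ⊓ ·) ⊤).IsQF := fun l => by
    induction l with
    | nil => exact fun _ => BoundedFormula.IsQF.top
    | cons φ l ih =>
      exact fun hl => (hl φ (by simp)).inf (ih fun ψ hψ => hl ψ (by simp [hψ]))
  refine key _ fun φ hφ => ?_
  obtain ⟨b, -, rfl⟩ := List.mem_map.1 hφ
  exact h b

theorem isQF_iSup {β : Type} [Finite β] {θ : β → L.BoundedFormula α n}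
    (h : ∀ b, (θ b).IsQF) : (BoundedFormula.iSup θ).IsQF := by
  have key : ∀ l : List (L.BoundedFormula α n), (∀ φ ∈ l, φ.IsQF) →
      (l.foldr (· ⊔ ·) ⊥).IsQF := fun l => by
    induction l with
    | nil => exact fun _ => BoundedFormula.isQF_bot
    | cons φ l ih =>
      exact fun hl => (hl φ (by simp)).sup (ih fun ψ hψ => hl ψ (by simp [hψ]))
  refine key _ fun φ hφ => ?_
  obtain ⟨b, -, rfl⟩ := List.mem_map.1 hφ
  exact h b

/-- If agreement on finitely many quantifier-free formulas implies agreement on `φ`, then `φ` is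
equivalent to a quantifier-free formula. -/
theorem exists_isQF_iff_of_finite {T : L.Theory} {β : Type} [Finite β] (θ : β → L.Formula α)
    (hθ : ∀ b, BoundedFormula.IsQF (θ b)) (φ : L.Formula α)
    (h : ∀ (M N : Theory.ModelType.{0, 0, 0} T) (v : α → M) (w : α → N),
      (∀ b, (θ b).Realize v ↔ (θ b).Realize w) → φ.Realize v → φ.Realize w) :
    ∃ ψ : L.Formula α, BoundedFormula.IsQF ψ ∧ T.Iff φ ψ := by
  classical
  -- The truth patterns compatible with `φ`. The quantifier-free formula is the disjunction over
  -- them of the conjunctions of the corresponding literals.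
  let good (S : Set β) : Prop := ∃ (M : Theory.ModelType.{0, 0, 0} T) (v : α → M),
    φ.Realize v ∧ ∀ b, b ∈ S ↔ (θ b).Realize v
  let lit (S : Set β) (b : β) : L.Formula α := if b ∈ S then θ b else (θ b).not
  have hlit (S : Set β) (b : β) (M : Theory.ModelType.{0, 0, 0} T) (v : α → M) :
      (lit S b).Realize v ↔ (b ∈ S ↔ (θ b).Realize v) := by
    by_cases hb : b ∈ S <;> simp [lit, hb]
  refine ⟨BoundedFormula.iSup fun S : {S : Set β // good S} => BoundedFormula.iInf (lit S.1),
    isQF_iSup fun S => isQF_iInf fun b => ?_, ?_⟩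
  · simp only [lit]
    split_ifs
    exacts [hθ b, (hθ b).not]
  · intro M v xs
    obtain rfl : xs = default := Subsingleton.elim _ _
    rw [BoundedFormula.realize_iff, BoundedFormula.realize_iSup]
    simp only [BoundedFormula.realize_iInf]
    constructor
    · intro hφ
      exact ⟨⟨{b | (θ b).Realize v}, M, v, hφ, fun _ => Iff.rfl⟩,
        fun b => (hlit _ b M v).2 Iff.rfl⟩
    · rintro ⟨⟨S, N, w, hw, hS⟩, hb⟩
      exact h N M w v (fun b => (hS b).symm.trans ((hlit S b M v).1 (hb b))) hw

end General

/-- The indices of the basic relations between the members of a tuple. -/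
inductive BasicIndex (α : Type)
  | point (i : α)
  | eq (i j : α)
  | fibEq (i j : α)
  | lt (i j : α)
  | circ (i j k : α)

instance {α : Type} [Finite α] : Finite (BasicIndex α) := by
  let e : BasicIndex α → α ⊕ (α × α) ⊕ (α × α) ⊕ (α × α) ⊕ (α × α × α)
    | .point i => .inl i
    | .eq i j => .inr (.inl (i, j))
    | .fibEq i j => .inr (.inr (.inl (i, j)))
    | .lt i j => .inr (.inr (.inr (.inl (i, j))))
    | .circ i j k => .inr (.inr (.inr (.inr (i, j, k))))
  refine Finite.of_injective e ?_
  rintro (_ | _ | _ | _ | _) (_ | _ | _ | _ | _) <;> simp [e]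

/-- The atomic formulas expressing the basic relations between the members of a tuple. -/
def basicFormula {α : Type} : BasicIndex α → Lang.Formula α
  | .point i => isPoint (var (.inl i))
  | .eq i j => Term.bdEqual (var (.inl i)) (var (.inl j))
  | .fibEq i j => Term.bdEqual (fT (var (.inl i))) (fT (var (.inl j)))
  | .lt i j => lessThan (fT (var (.inl i))) (fT (var (.inl j)))
  | .circ i j k => circ (var (.inl i)) (var (.inl j)) (var (.inl k)) (fT (var (.inl i)))

theorem isQF_basicFormula {α : Type} (b : BasicIndex α) :
    BoundedFormula.IsQF (basicFormula b) := by
  cases b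
  · exact (BoundedFormula.IsAtomic.rel _ _).isQF
  · exact (BoundedFormula.IsAtomic.equal _ _).isQF
  · exact (BoundedFormula.IsAtomic.equal _ _).isQF
  · exact (BoundedFormula.IsAtomic.rel _ _).isQF
  · exact (BoundedFormula.IsAtomic.rel _ _).isQF

theorem sim_of_basicFormula {M N : Type u} [Lang.Structure M] [Lang.Structure N] {α : Type}
    {v : α → M} {w : α → N}
    (h : ∀ b, (basicFormula b).Realize v ↔ (basicFormula b).Realize w) : Sim v w := by
  refine ⟨fun i => ?_, fun i j => ?_, fun i j => ?_, fun i j => ?_, fun i j k => ?_⟩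
  · simpa [basicFormula, Formula.Realize, realize_isPoint] using h (.point i)
  · simpa [basicFormula, Formula.Realize] using h (.eq i j)
  · simpa [basicFormula, Formula.Realize, realize_fT] using h (.fibEq i j)
  · simpa [basicFormula, Formula.Realize, realize_lessThan, realize_fT] using h (.lt i j)
  · simpa [basicFormula, Formula.Realize, realize_circ, realize_fT] using h (.circ i j k)

theorem isFibred_of_model (M : Type u) [Lang.Structure M] [h : M ⊨ fibreTheory] : IsFibred M :=
  model_iff_isFibred.1 h

theorem exists_isQF_iff {α : Type} [Finite α] (φ : Lang.Formula α) :
    ∃ ψ : Lang.Formula α, BoundedFormula.IsQF ψ ∧ fibreTheory.Iff φ ψ :=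
  exists_isQF_iff_of_finite basicFormula isQF_basicFormula φ fun M N _ _ h =>
    ((sim_of_basicFormula h).formula_realize_iff (isFibred_of_model M) (isFibred_of_model N) φ).1

theorem hasQE_fibreTheory : HasQE fibreTheory := fun _ φ => exists_isQF_iff φ

/-! ### A model, and completeness -/

/-- A concrete model: the sets are the rationals, each fibre is a copy of the rationals with the
circular order induced by the linear order. -/
abbrev RatModel : Type := ℚ ⊕ (ℚ × ℚ)

/-- The circular order induced by the linear order of the rationals. -/
def ratCirc (x y z : ℚ) : Prop := (x < y ∧ y < z) ∨ (y < z ∧ z < x) ∨ (z < x ∧ x < y)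

instance : Lang.Structure RatModel where
  funMap := fun {_} g => match g with
    | .f => fun x => (x 0).elim .inl fun p => .inl p.1
  RelMap := fun {_} r => match r with
    | .point => fun x => ∃ p, x 0 = .inr p
    | .set => fun x => ∃ s, x 0 = .inl s
    | .lt => fun x => ∃ s t, x 0 = .inl s ∧ x 1 = .inl t ∧ s < t
    | .circ => fun x => ∃ s a b c, x 0 = .inr (s, a) ∧ x 1 = .inr (s, b) ∧ x 2 = .inr (s, c) ∧
        x 3 = .inl s ∧ ratCirc a b c

theorem isFibred_ratModel : IsFibred RatModel := by
  have hpt (x : RatModel) : Pt x ↔ ∃ p, x = .inr p := Iff.rfl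
  have hst (x : RatModel) : InSets x ↔ ∃ s, x = .inl s := Iff.rfl
  have hlt (x y : RatModel) : Lt x y ↔ ∃ s t, x = .inl s ∧ y = .inl t ∧ s < t := Iff.rfl
  have hc (x y z w : RatModel) : Circ x y z w ↔ ∃ s a b c, x = .inr (s, a) ∧ y = .inr (s, b) ∧
    z = .inr (s, c) ∧ w = .inl s ∧ ratCirc a b c := Iff.rfl
  have hf₁ (s : ℚ) : fib (.inl s : RatModel) = .inl s := rfl
  have hf₂ (p : ℚ × ℚ) : fib (.inr p : RatModel) = .inl p.1 := rfl
  constructor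
  · rintro (x | x) <;> simp [hpt, hst]
  · rintro (x | x) <;> simp [hpt, hst]
  · rintro (x | x) <;> simp [hst, hf₁, hf₂]
  · rintro (x | x) <;> simp [hst, hf₁]
  · rintro (x | x) (y | y) <;> simp [hlt, hst]
  · rintro (x | x) <;> simp [hlt]
  · rintro (x | x) (y | y) (z | z) <;> simp [hlt]
    exact lt_trans
  · rintro (x | x) (y | y) <;> simp [hlt, hst]
    exact lt_trichotomy x y
  · rintro (x | x) (y | y) <;> simp [hlt]
    exact exists_between
  · rintro (x | x) <;> simp [hlt, hst]
    exact exists_lt x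
  · rintro (x | x) <;> simp [hlt, hst]
    exact exists_gt x
  · rintro _ _ _ _ ⟨s, a, b, c, rfl, rfl, rfl, rfl, -⟩
    simp [hpt, hf₂]
  · rintro _ _ _ _ ⟨s, a, b, c, rfl, rfl, rfl, rfl, h⟩
    exact ⟨s, b, c, a, rfl, rfl, rfl, rfl, by unfold ratCirc at *; tauto⟩
  · simp only [hc]
    rintro _ _ _ _ ⟨s, a, b, c, rfl, rfl, rfl, rfl, h⟩ ⟨s', c', b', a', h₁, h₂, h₃, -, h'⟩
    simp only [Sum.inr.injEq, Prod.mk.injEq] at h₁ h₂ h₃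
    obtain ⟨⟨rfl, rfl⟩, ⟨-, rfl⟩, ⟨-, rfl⟩⟩ := And.intro h₁ (And.intro h₂ h₃)
    unfold ratCirc at *
    grind
  · simp only [hc]
    rintro _ _ _ _ _ ⟨s, a, b, c, rfl, rfl, rfl, rfl, h⟩ ⟨s', a', c', d, h₁, h₂, rfl, h₃, h'⟩
    simp only [Sum.inr.injEq, Prod.mk.injEq] at h₁ h₂
    obtain ⟨⟨rfl, rfl⟩, ⟨-, rfl⟩⟩ := And.intro h₁ h₂
    exact ⟨s, a, b, d, rfl, rfl, rfl, rfl, by unfold ratCirc at *; grind⟩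
  · rintro _ _ _ s ⟨⟨s₁, a⟩, rfl⟩ rfl ⟨⟨s₂, b⟩, rfl⟩ h₁ ⟨⟨s₃, c⟩, rfl⟩ h₂ hxy hyz hxz
    simp only [hf₂, Sum.inl.injEq] at h₁ h₂
    subst h₁ h₂
    simp only [ne_eq, Sum.inr.injEq, Prod.mk.injEq, true_and] at hxy hyz hxz
    rcases lt_or_gt_of_ne hxy with h₁ | h₁ <;> rcases lt_or_gt_of_ne hyz with h₂ | h₂ <;>
    rcases lt_or_gt_of_ne hxz with h₃ | h₃ <;>
    simp [hc, hf₂, ratCirc, h₁, h₂, h₃]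
  · rintro _ _ s ⟨⟨s₁, a⟩, rfl⟩ rfl ⟨⟨s₂, b⟩, rfl⟩ h₁ hne
    simp only [hf₂, Sum.inl.injEq] at h₁
    subst h₁
    simp only [ne_eq, Sum.inr.injEq, Prod.mk.injEq, true_and] at hne
    rcases lt_or_gt_of_ne hne with h | h
    · obtain ⟨z, h₁, h₂⟩ := exists_between h
      exact ⟨.inr (_, z), _, a, z, b, rfl, rfl, rfl, rfl, .inl ⟨h₁, h₂⟩⟩
    · obtain ⟨z, h₁⟩ := exists_gt a
      exact ⟨.inr (_, z), _, a, z, b, rfl, rfl, rfl, rfl, .inr (.inr ⟨h, h₁⟩)⟩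
  · rintro _ ⟨s, rfl⟩ k t
    have hinj : Function.Injective fun q : ℚ => (.inr (s, q) : RatModel) := fun q r h => by
      simpa using h
    obtain ⟨x, ⟨q, rfl⟩, hq⟩ :=
      (Set.infinite_range_of_injective hinj).exists_notMem_finite (Set.finite_range t)
    exact ⟨_, ⟨_, rfl⟩, rfl, fun i h => hq ⟨i, h.symm⟩⟩

instance : RatModel ⊨ fibreTheory := model_iff_isFibred.2 isFibred_ratModel

/-- Empty tuples in any two models are vacuously similar, so all models satisfy the same sentences.
-/
theorem isComplete_fibreTheory : fibreTheory.IsComplete := by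
  refine ⟨⟨Theory.ModelType.of fibreTheory RatModel⟩, fun φ => ?_⟩
  have key (M N : Theory.ModelType.{0, 0, 0} fibreTheory) : M ⊨ φ → N ⊨ φ :=
    (Sim.formula_realize_iff (isFibred_of_model M) (isFibred_of_model N) φ
      ⟨fun i => i.elim, fun i => i.elim, fun i => i.elim, fun i => i.elim, fun i => i.elim⟩).1
  simp only [Theory.models_sentence_iff, Sentence.realize_not]
  by_contra! h
  obtain ⟨⟨M, hM⟩, N, hN⟩ := h
  exact hM (key N M hN)

end ForkDiv

namespace ForkDiv

open FirstOrder.Language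

/-! ### Dependence -/

/-- Every sequence of left arguments has a subsequence along which, for every fixed right argument,
the truth value of the relation is eventually constant. -/
def SeqConverges {X Y : Type*} (R : X → Y → Prop) : Prop :=
  ∀ a : ℕ → X, ∃ g : ℕ → ℕ, StrictMono g ∧
    ∀ y, (∀ᶠ i in Filter.atTop, R (a (g i)) y) ∨ ∀ᶠ i in Filter.atTop, ¬ R (a (g i)) y

namespace SeqConverges

variable {X Y P : Type*} {R S : X → Y → Prop}

theorem congr (hR : SeqConverges R) (h : ∀ x y, R x y ↔ S x y) : SeqConverges S := by
  rwa [← (funext₂ fun x y => propext (h x y) : R = S)]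

theorem not (hR : SeqConverges R) : SeqConverges fun x y => ¬ R x y := fun a => by
  obtain ⟨g, hg, h⟩ := hR a
  exact ⟨g, hg, fun y => by simpa only [not_not] using (h y).symm⟩

theorem and (hR : SeqConverges R) (hS : SeqConverges S) : SeqConverges fun x y => R x y ∧ S x y :=
  fun a => by
  obtain ⟨g, hg, h⟩ := hR a
  obtain ⟨k, hk, h'⟩ := hS (a ∘ g)
  refine ⟨g ∘ k, hg.comp hk, fun y => ?_⟩
  rcases h y with h₁ | h₁
  · rcases h' y with h₂ | h₂
    · exact .inl ((hk.tendsto_atTop.eventually h₁).and h₂)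
    · exact .inr (h₂.mono fun i hi hi' => hi hi'.2)
  · exact .inr ((hk.tendsto_atTop.eventually h₁).mono fun i hi hi' => hi hi'.1)

theorem or (hR : SeqConverges R) (hS : SeqConverges S) : SeqConverges fun x y => R x y ∨ S x y := by
  simpa only [not_and_or, not_not] using (hR.not.and hS.not).not

theorem imp (hR : SeqConverges R) (hS : SeqConverges S) :
    SeqConverges fun x y => R x y → S x y := by
  simpa only [imp_iff_not_or] using hR.not.or hS

theorem right (p : Y → Prop) : SeqConverges fun (_ : X) y => p y := fun _ =>
  ⟨id, strictMono_id, fun y => by by_cases h : p y <;> simp [h]⟩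

theorem left (p : X → Prop) : SeqConverges fun x (_ : Y) => p x := fun a => by
  -- Applied to a relation ignoring its second argument, this is the infinite pigeonhole principle
  -- for `p`.
  obtain ⟨g, hg⟩ := exists_increasing_or_nonincreasing_subseq' (fun x _ : X => p x) a
  refine ⟨g, g.strictMono, fun _ => hg.imp (fun h => .of_forall h) fun h => .of_forall fun i => ?_⟩
  exact h i (i + 1) (Nat.lt_succ_self i)

theorem comp {X' Y' : Type*} (hR : SeqConverges R) (f : X' → X) (k : Y' → Y) :
    SeqConverges fun x y => R (f x) (k y) := fun a => by
  obtain ⟨g, hg, h⟩ := hR (f ∘ a)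
  exact ⟨g, hg, fun y => h (k y)⟩

theorem not_shattered (hR : SeqConverges R) (a : ℕ → X) (b : Set ℕ → Y) :
    ¬ ∀ i w, R (a i) (b w) ↔ i ∈ w := fun hab => by
  obtain ⟨g, hg, h⟩ := hR a
  -- For this subset the truth value alternates along the subsequence.
  have hmem (i : ℕ) : g i ∈ g '' {j | Even j} ↔ Even i := hg.injective.mem_set_image
  rcases h (b (g '' {j | Even j})) with h | h <;> simp only [hab, hmem] at h <;>
  obtain ⟨n, hn⟩ := Filter.eventually_atTop.1 h
  · exact absurd (hn (2 * n + 1) (by omega)) (by simp)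
  · exact hn (2 * n) (by omega) (by simp)

/-- A family of strict weak orders, one on each fibre of `κ`, converges along subsequences. -/
theorem of_weakOrder {r : P → P → Prop} (htr : ∀ {x y z}, r x y → r y z → r x z) {K : Type*}
    (κ : P → K) (hκ : ∀ {x y}, r x y → κ x = κ y)
    (hw : ∀ {x y z}, κ x = κ y → r x z → r x y ∨ r y z) : SeqConverges r := fun a => by
  -- Thin out until the fibres are all equal or pairwise different, then until `r` holds for all
  -- increasing pairs or for none.
  obtain ⟨g, hg⟩ := exists_increasing_or_nonincreasing_subseq (fun k l : K => k = l) (κ ∘ a)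
  have : IsTrans P r := ⟨fun _ _ _ => htr⟩
  obtain ⟨k, hk⟩ := exists_increasing_or_nonincreasing_subseq r (a ∘ g)
  refine ⟨g ∘ k, g.strictMono.comp k.strictMono, fun y => ?_⟩
  simp only [Function.comp_apply] at hg hk ⊢
  by_cases hex : ∃ n, r (a (g (k n))) y
  · obtain ⟨n, hn⟩ := hex
    rcases hk with hk | hk
    -- Along an increasing sequence one failure at `y` forces all later failures.
    · by_cases hall : ∀ m, r (a (g (k m))) y
      · exact .inl (.of_forall hall)
      · push Not at hall
        obtain ⟨m, hm⟩ := hall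
        refine .inr (Filter.eventually_atTop.2 ⟨m + 1, fun i hi hiy => hm ?_⟩)
        exact htr (hk m i (by omega)) hiy
    -- In a single fibre, one success passes to all later terms by `hw`; in different fibres, at
    -- most one term can be related to `y`.
    · rcases hg with hg | hg
      · refine .inl (Filter.eventually_atTop.2 ⟨n + 1, fun i hi => ?_⟩)
        exact (hw (hg _ _ (k.strictMono (by omega : n < i))) hn).resolve_left (hk n i (by omega))
      · refine .inr (Filter.eventually_atTop.2 ⟨n + 1, fun i hi hiy => ?_⟩)
        exact hg _ _ (k.strictMono (by omega : n < i)) ((hκ hn).trans (hκ hiy).symm)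
  · push Not at hex
    exact .inr (.of_forall hex)

/-- An equality or a strict weak order between two functions, each depending on one argument
only. -/
theorem of_separated {r : P → P → Prop} (h₁ : SeqConverges r) (h₂ : SeqConverges fun x y => r y x)
    {s t : X → Y → P} (hs : (∃ p : X → P, ∀ x y, s x y = p x) ∨ ∃ p : Y → P, ∀ x y, s x y = p y)
    (ht : (∃ p : X → P, ∀ x y, t x y = p x) ∨ ∃ p : Y → P, ∀ x y, t x y = p y) :
    SeqConverges fun x y => r (s x y) (t x y) := by
  rcases hs with ⟨p, hp⟩ | ⟨p, hp⟩ <;> rcases ht with ⟨q, hq⟩ | ⟨q, hq⟩ <;> simp only [hp, hq]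
  · exact left fun x => r (p x) (q x)
  · exact h₁.comp p q
  · exact h₂.comp q p
  · exact right fun y => r (p y) (q y)

end SeqConverges

/-! ### Convergence for the basic relations of a fibred structure -/

section

variable {M : Type u} [Lang.Structure M]

/-- A choice of a base point in each fibre that contains a point. -/
noncomputable def basePoint (s : M) : M :=
  open Classical in if h : ∃ b, Pt b ∧ fib b = s then h.choose else s

theorem basePoint_spec {x : M} (hx : Pt x) :
    Pt (basePoint (fib x)) ∧ fib (basePoint (fib x)) = fib x := by
  have h : ∃ b : M, Pt b ∧ fib b = fib x := ⟨x, hx, rfl⟩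
  rw [basePoint, dif_pos h]
  exact h.choose_spec

/-- The linear orders on the fibres obtained by cutting the circular orders at base points. -/
def BaseLt (x y : M) : Prop := CutLt (basePoint (fib x)) x y

theorem baseLt_fib {x y : M} (hxy : BaseLt x y) : fib x = fib y :=
  hxy.1.2.trans hxy.2.1.2.symm

namespace IsFibred

variable (h : IsFibred M)
include h

theorem baseLt_trans {x y z : M} (hxy : BaseLt x y) (hyz : BaseLt y z) : BaseLt x z := by
  have he := baseLt_fib hxy
  unfold BaseLt at *
  rw [← he] at hyz
  exact h.cutLt_trans hxy hyz

theorem baseLt_total {x y : M} (hx : Pt x) (hy : Pt y) (he : fib x = fib y) :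
    BaseLt x y ∨ x = y ∨ BaseLt y x := by
  obtain ⟨hb, hbf⟩ := basePoint_spec hx
  unfold BaseLt
  rw [← he]
  exact h.cutLt_total hb ⟨hx, hbf.symm⟩ ⟨hy, he.symm.trans hbf.symm⟩

/-- The ternary relation becomes a Boolean combination of binary and unary ones, each separable
between the two sides of a partitioned formula. The base points need not be definable, since
convergence concerns arbitrary relations. -/
theorem circ_iff_baseLt {x y z s : M} :
    Circ x y z s ↔ (Pt x ∧ fib x = s ∧ fib y = s ∧ fib z = s) ∧
      ((BaseLt x y ∧ BaseLt y z) ∨ (BaseLt y z ∧ BaseLt z x) ∨ (BaseLt z x ∧ BaseLt x y)) := by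
  have key (hx : Pt x) (hxs : fib x = s) (hys : fib y = s) (hzs : fib z = s) :
      Circ x y z s ↔
        (BaseLt x y ∧ BaseLt y z) ∨ (BaseLt y z ∧ BaseLt z x) ∨ (BaseLt z x ∧ BaseLt x y) := by
    obtain ⟨hb, hbf⟩ := basePoint_spec hx
    unfold BaseLt
    rw [hxs] at hb hbf
    rw [hxs, hys, hzs, h.circ_iff_cutLt hb hbf]
  constructor
  · intro hc
    obtain ⟨⟨hx, hxs⟩, ⟨-, hys⟩, -, hzs⟩ := h.circ_fib hc
    exact ⟨⟨hx, hxs, hys, hzs⟩, (key hx hxs hys hzs).1 hc⟩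
  · rintro ⟨⟨hx, hxs, hys, hzs⟩, hc⟩
    exact (key hx hxs hys hzs).2 hc

theorem seqConverges_baseLt : SeqConverges (BaseLt (M := M)) := by
  -- The sort is part of the key because a set `s` satisfies `fib s = s`, while the cut order is
  -- total only on points.
  refine SeqConverges.of_weakOrder h.baseLt_trans (fun x => (fib x, Pt x))
    (fun hxy => Prod.ext (baseLt_fib hxy) (propext (iff_of_true hxy.1.1 hxy.2.1.1))) ?_
  intro x y z he hxz
  simp only [Prod.mk.injEq] at he
  have hx := hxz.1.1
  rcases h.baseLt_total hx (he.2 ▸ hx) he.1 with h₁ | rfl | h₁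
  exacts [.inl h₁, .inr hxz, .inr (h.baseLt_trans h₁ hxz)]

theorem seqConverges_baseLt_swap : SeqConverges fun x y : M => BaseLt y x := by
  refine SeqConverges.of_weakOrder (fun h₁ h₂ => h.baseLt_trans h₂ h₁) (fun x => (fib x, Pt x))
    (fun hxy => (Prod.ext (baseLt_fib hxy) (propext (iff_of_true hxy.1.1 hxy.2.1.1))).symm) ?_
  intro x y z he hxz
  simp only [Prod.mk.injEq] at he
  have hx := hxz.2.1.1
  rcases h.baseLt_total hx (he.2 ▸ hx) he.1 with h₁ | rfl | h₁
  exacts [.inr (h.baseLt_trans hxz h₁), .inr hxz, .inl h₁]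

theorem seqConverges_lt_fib : SeqConverges fun x y : M => Lt (fib x) (fib y) := by
  refine SeqConverges.of_weakOrder h.lt_trans (fun _ => ()) (fun _ => rfl) ?_
  intro x y z _ hxz
  rcases h.lt_total (h.inSets_fib x) (h.inSets_fib y) with h₁ | h₁ | h₁
  exacts [.inl h₁, .inr (h₁ ▸ hxz), .inr (h.lt_trans h₁ hxz)]

theorem seqConverges_lt_fib_swap : SeqConverges fun x y : M => Lt (fib y) (fib x) := by
  refine SeqConverges.of_weakOrder (fun h₁ h₂ => h.lt_trans h₂ h₁) (fun _ => ()) (fun _ => rfl) ?_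
  intro x y z _ hxz
  rcases h.lt_total (h.inSets_fib x) (h.inSets_fib y) with h₁ | h₁ | h₁
  exacts [.inr (h.lt_trans hxz h₁), .inr (h₁ ▸ hxz), .inl h₁]

/-- Every term involves at most one variable, so its value depends on only one of the two sides;
binary relations between such values converge by `of_separated`. -/
theorem seqConverges_of_isQF {X Y α : Type*} {v : X → Y → α → M}
    (hv : ∀ i, (∃ p : X → M, ∀ x y, v x y i = p x) ∨ ∃ p : Y → M, ∀ x y, v x y i = p y)
    {φ : Lang.BoundedFormula α 0} (hφ : φ.IsQF) :
    SeqConverges fun x y => φ.Realize (v x y) default := by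
  have hterm (t : Lang.Term (α ⊕ Fin 0)) :
      (∃ p : X → M, ∀ x y, t.realize (Sum.elim (v x y) default) = p x) ∨
        ∃ p : Y → M, ∀ x y, t.realize (Sum.elim (v x y) default) = p y := by
    obtain ⟨(i | i) | (i | i), hi⟩ := exists_realize_eq.{u, _} t
    · simpa [hi M h] using hv i
    · exact i.elim0
    · refine (hv i).imp ?_ ?_ <;>
      · rintro ⟨p, hp⟩
        exact ⟨fun x => fib (p x), fun x y => by simp [hi M h, hp]⟩
    · exact i.elim0
  have hfib {s : X → Y → M}
      (hs : (∃ p : X → M, ∀ x y, s x y = p x) ∨ ∃ p : Y → M, ∀ x y, s x y = p y) :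
      (∃ p : X → M, ∀ x y, fib (s x y) = p x) ∨ ∃ p : Y → M, ∀ x y, fib (s x y) = p y :=
    hs.imp (fun ⟨p, hp⟩ => ⟨fun x => fib (p x), fun x y => by rw [hp]⟩)
      fun ⟨p, hp⟩ => ⟨fun x => fib (p x), fun x y => by rw [hp]⟩
  have hpt {s : X → Y → M}
      (hs : (∃ p : X → M, ∀ x y, s x y = p x) ∨ ∃ p : Y → M, ∀ x y, s x y = p y) :
      SeqConverges fun x y => Pt (s x y) := by
    rcases hs with ⟨p, hp⟩ | ⟨p, hp⟩ <;> simp only [hp]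
    exacts [.left fun x => Pt (p x), .right fun y => Pt (p y)]
  have heq : SeqConverges fun x y : M => x = y :=
    .of_weakOrder Eq.trans id id fun h₁ _ => .inl h₁
  have heq' : SeqConverges fun x y : M => y = x := by simpa only [eq_comm] using heq
  induction hφ with
  | falsum => exact .right fun _ => False
  | imp _ _ ih₁ ih₂ => exact ih₁.imp ih₂
  | of_isAtomic hφ =>
    cases hφ with
    | equal s t =>
      simp only [BoundedFormula.realize_bdEqual]
      exact .of_separated heq heq' (hterm s) (hterm t)
    | rel R ts =>
      have lt (i j) := SeqConverges.of_separated h.seqConverges_lt_fib h.seqConverges_lt_fib_swap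
        (hterm (ts i)) (hterm (ts j))
      have base (i j) := SeqConverges.of_separated h.seqConverges_baseLt h.seqConverges_baseLt_swap
        (hterm (ts i)) (hterm (ts j))
      have fib_eq (i j) := SeqConverges.of_separated heq heq' (hfib (hterm (ts i))) (hterm (ts j))
      simp only [BoundedFormula.realize_rel]
      cases R
      · simp only [relMap_point]
        exact hpt (hterm _)
      · simp only [relMap_set, ← h.not_pt_iff]
        exact (hpt (hterm _)).not
      · refine .congr ?_ fun x y => ((relMap_lt _).trans (h.lt_iff _ _)).symm
        exact (hpt (hterm _)).not.and ((hpt (hterm _)).not.and (lt 0 1))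
      · simp only [relMap_circ, h.circ_iff_baseLt]
        exact ((hpt (hterm _)).and ((fib_eq 0 3).and ((fib_eq 1 3).and (fib_eq 2 3)))).and
          (((base 0 1).and (base 1 2)).or (((base 1 2).and (base 2 0)).or
            ((base 2 0).and (base 0 1))))

end IsFibred

end

theorem isDependent_fibreTheory : IsDependent.{u} fibreTheory := by
  rintro ⟨P, n, m, φ, a, b, h⟩
  obtain ⟨ψ, hψ, hφψ⟩ := exists_isQF_iff φ
  refine ((isFibred_of_model P).seqConverges_of_isQF (X := Fin n → P) (Y := Fin m → P)
    (v := Sum.elim) ?_ hψ).not_shattered a b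
      fun i w => (hφψ.realize_iff.symm.trans (h i w))
  rintro (i | i)
  exacts [.inl ⟨fun x => x i, fun _ _ => rfl⟩, .inr ⟨fun y => y i, fun _ _ => rfl⟩]

end ForkDiv

namespace ForkDiv

open FirstOrder.Language

/-! ### Saturation of ultraproducts -/

/-- A diagonal argument: the type is countable, say `φ 0, φ 1, …`, and `X n` satisfies its first `n`
formulas on almost all coordinates by Łoś. The realization uses, at coordinate `j`, an `X n` with
`n` as large as possible. -/
theorem isSaturated_hyperfilter_product {L : FirstOrder.Language.{0, 0}} [Countable L.Symbols]
    (M : ℕ → Type u) [∀ n, L.Structure (M n)] [∀ n, Nonempty (M n)] {κ : Cardinal.{u}}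
    (hκ : κ ≤ Order.succ Cardinal.aleph0) :
    IsSaturated L ((Filter.hyperfilter ℕ : Filter ℕ).Product M) κ := by
  classical
  intro A hA p hp
  have : Countable A := Cardinal.mk_le_aleph0_iff.1 (Order.lt_succ_iff.1 (hA.trans_le hκ))
  rcases p.eq_empty_or_nonempty with rfl | hne
  · exact ⟨Classical.arbitrary _, by simp⟩
  obtain ⟨φ, rfl⟩ := (Set.to_countable p).exists_eq_range hne
  choose rep hrep using fun c : A => Quotient.exists_rep c.1
  have realize (ψ : L.Formula (A ⊕ Unit)) (X : ∀ j, M j) :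
      ψ.Realize (Sum.elim (fun c : A => (c : (Filter.hyperfilter ℕ : Filter ℕ).Product M))
        fun _ => (X : (Filter.hyperfilter ℕ : Filter ℕ).Product M)) ↔
      ∀ᶠ j in (Filter.hyperfilter ℕ : Filter ℕ),
        ψ.Realize (Sum.elim (fun c => rep c j) fun _ => X j) := by
    have key := Ultraproduct.realize_formula_cast (u := Filter.hyperfilter ℕ) ψ
      (Sum.elim rep fun _ => X)
    convert! key using 2
    · funext i
      rcases i with c | _
      exacts [(hrep c).symm, rfl]
    · congr! 2
      funext i
      rcases i with c | _ <;> rfl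
  have hfin (n : ℕ) : ∃ X : ∀ j, M j, ∀ᶠ j in (Filter.hyperfilter ℕ : Filter ℕ),
      ∀ i ∈ Finset.range n, (φ i).Realize (Sum.elim (fun c => rep c j) fun _ => X j) := by
    obtain ⟨x, hx⟩ := hp ((Finset.range n).image φ) (by
      intro ψ hψ
      obtain ⟨i, -, rfl⟩ := Finset.mem_image.1 hψ
      exact ⟨i, rfl⟩)
    obtain ⟨X, rfl⟩ := Quotient.exists_rep x
    refine ⟨X, (Filter.eventually_all_finset _).2 fun i hi => ?_⟩
    exact (realize (φ i) X).1 (hx _ (Finset.mem_image_of_mem _ hi))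
  choose X hX using hfin
  let good (j n : ℕ) : Prop :=
    ∀ i ∈ Finset.range n, (φ i).Realize (Sum.elim (fun c => rep c j) fun _ => X n j)
  -- The bound `n ≤ j` makes the maximum exist; it is harmless because almost all `j` exceed any
  -- given number.
  let d (j : ℕ) : ℕ := Nat.findGreatest (good j) j
  refine ⟨((fun j => X (d j) j : ∀ j, M j) : (Filter.hyperfilter ℕ : Filter ℕ).Product M), ?_⟩
  rintro _ ⟨i, rfl⟩
  rw [realize]
  filter_upwards [hX (i + 1), Nat.hyperfilter_le_atTop (Filter.eventually_ge_atTop (i + 1))]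
    with j hj hij
  have hle : i + 1 ≤ d j := Nat.le_findGreatest hij hj
  exact Nat.findGreatest_spec (P := good j) hij hj i (Finset.mem_range.2 hle)

/-! ### A saturated model over a countable elementary substructure -/

instance : Countable Lang.Symbols := by
  have h₁ : Countable (Σ n, Func n) :=
    Function.Injective.countable (f := fun _ => ()) (by rintro ⟨_, _ | _⟩ ⟨_, _ | _⟩ _; rfl)
  have h₂ : Countable (Σ n, Rel n) := by
    let e : (Σ n, Rel n) → ℕ := fun r => match r with
      | ⟨_, .point⟩ => 0
      | ⟨_, .set⟩ => 1
      | ⟨_, .lt⟩ => 2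
      | ⟨_, .circ⟩ => 3
    refine Function.Injective.countable (f := e) ?_
    rintro ⟨_, _ | _⟩ ⟨_, _ | _⟩ h <;> simp_all [e]
  exact inferInstanceAs (Countable ((Σ n, Func n) ⊕ (Σ n, Rel n)))

theorem IsFibred.infinite_inSets {M : Type u} [Lang.Structure M] [Nonempty M] (h : IsFibred M) :
    {s : M | InSets s}.Infinite := fun hfin => by
  obtain ⟨m, hm, hlt, -⟩ := h.exists_lt_cut hfin Set.finite_empty (fun _ hx => hx) (by simp)
    (by simp)
  exact h.lt_irrefl m (hlt m hm)

theorem exists_isSaturated :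
    ∃ (N : Type u) (_ : Lang.Structure N) (M : Lang.ElementarySubstructure N),
      Nonempty N ∧ N ⊨ fibreTheory ∧ IsSaturated Lang N (Order.succ (Cardinal.mk M)) := by
  let P : Theory.ModelType.{0, 0, u} fibreTheory :=
    (Theory.ModelType.of fibreTheory RatModel).ulift
  let N := (Filter.hyperfilter ℕ : Filter ℕ).Product fun _ => P
  have hN : N ⊨ fibreTheory := Theory.model_iff _ |>.2 fun φ hφ =>
    (Ultraproduct.sentence_realize φ).2 (.of_forall fun _ => P.is_model.realize_of_mem φ hφ)
  have : Infinite N := Set.infinite_univ_iff.1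
    ((isFibred_of_model N).infinite_inSets.mono (Set.subset_univ _))
  -- With `M` countable, the successor of its cardinality is exactly the saturation of the
  -- ultrapower.
  obtain ⟨M, -, hM⟩ := exists_elementarySubstructure_card_eq Lang (M := N) ∅ Cardinal.aleph0.{u}
    le_rfl (by simp)
    (by
      rw [Cardinal.lift_aleph0, Cardinal.lift_le_aleph0]
      exact Cardinal.mk_le_aleph0 (α := Lang.Symbols))
    (by simp [Cardinal.aleph0_le_mk])
  refine ⟨N, inferInstance, M, inferInstance, hN, isSaturated_hyperfilter_product _ ?_⟩
  simp only [Cardinal.lift_id] at hM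
  rw [hM]

end ForkDiv

namespace ForkDiv

open FirstOrder.Language

/-! ### Forking and dividing of the fibre formula -/

section

variable {N : Type u} [Lang.Structure N]

/-- The formula `x = y₀ ∨ C(y₀, x, y₁, f(y₀))`, defining a half-open arc. -/
def arcFormula : Lang.Formula (Fin 1 ⊕ Fin 2) :=
  Term.bdEqual (var (.inl (.inl 0))) (var (.inl (.inr 0))) ⊔
    circ (var (.inl (.inr 0))) (var (.inl (.inl 0))) (var (.inl (.inr 1)))
      (fT (var (.inl (.inr 0))))

theorem realize_arcFormula (x : Fin 1 → N) (y : Fin 2 → N) :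
    arcFormula.Realize (Sum.elim x y) ↔ x 0 = y 0 ∨ Circ (y 0) (x 0) (y 1) (fib (y 0)) := by
  simp [arcFormula, Formula.Realize, realize_circ, realize_fT]

theorem realize_fibreFormula (x : Fin 1 → N) (s : N) :
    fibreFormula.Realize (Sum.elim x ![s]) ↔ Pt (x 0) ∧ fib (x 0) = s := by
  simp [fibreFormula, Formula.Realize, realize_inFibre]

namespace IsFibred

variable (h : IsFibred N)
include h

/-- Pairs of distinct points of a fibre are indiscernible from each other over a tuple that has no
member in this fibre. -/
theorem sim_of_fibre {ι : Type*} {t : ι → N} {s : N} (ht : ∀ i, Pt (t i) → fib (t i) ≠ s)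
    {p q : Fin 2 → N} (hp : ∀ j, Pt (p j) ∧ fib (p j) = s) (hq : ∀ j, Pt (q j) ∧ fib (q j) = s)
    (hpi : Function.Injective p) (hqi : Function.Injective q) :
    Sim (Sum.elim t p) (Sum.elim t q) := by
  have hne {p : Fin 2 → N} (hp : ∀ j, Pt (p j) ∧ fib (p j) = s) (i : ι) (j : Fin 2) :
      t i ≠ p j := fun e => ht i (e ▸ (hp j).1) (e ▸ (hp j).2)
  have hcirc {p : Fin 2 → N} (hp : ∀ j, Pt (p j) ∧ fib (p j) = s) {x y z s' : N} (i : ι) (j : Fin 2)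
      (h₁ : x = t i ∨ y = t i ∨ z = t i) (h₂ : x = p j ∨ y = p j ∨ z = p j) :
      ¬ Circ x y z s' := fun hc => by
    obtain ⟨hx, hy, hz⟩ := h.circ_fib hc
    have hs : s' = s := by
      rcases h₂ with rfl | rfl | rfl
      exacts [hx.2.symm.trans (hp j).2, hy.2.symm.trans (hp j).2, hz.2.symm.trans (hp j).2]
    subst hs
    rcases h₁ with rfl | rfl | rfl
    exacts [ht i hx.1 hx.2, ht i hy.1 hy.2, ht i hz.1 hz.2]
  -- A circular triple has three distinct entries, which two points cannot supply.
  have hcirc' {p : Fin 2 → N} {s' : N} (i j k : Fin 2) : ¬ Circ (p i) (p j) (p k) s' := fun hc => by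
    obtain ⟨h₁, h₂, h₃⟩ := h.circ_ne hc
    have h₁ := ne_of_apply_ne p h₁
    have h₂ := ne_of_apply_ne p h₂
    have h₃ := ne_of_apply_ne p h₃
    omega
  refine ⟨?_, ?_, ?_, ?_, ?_⟩
  · rintro (i | i) <;> simp [(hp _).1, (hq _).1]
  · rintro (i | i) (j | j) <;>
      simp [hne hp, hne hq, (hne hp _ _).symm, (hne hq _ _).symm, hpi.eq_iff, hqi.eq_iff]
  · rintro (i | i) (j | j) <;> simp [(hp _).2, (hq _).2]
  · rintro (i | i) (j | j) <;> simp [(hp _).2, (hq _).2]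
  · rintro (i | i) (j | j) (k | k) <;> simp only [Sum.elim_inl, Sum.elim_inr]
    · exact iff_of_false (hcirc hp i k (by simp) (by simp)) (hcirc hq i k (by simp) (by simp))
    · exact iff_of_false (hcirc hp i j (by simp) (by simp)) (hcirc hq i j (by simp) (by simp))
    · exact iff_of_false (hcirc hp i k (by simp) (by simp)) (hcirc hq i k (by simp) (by simp))
    · exact iff_of_false (hcirc hp j i (by simp) (by simp)) (hcirc hq j i (by simp) (by simp))
    · exact iff_of_false (hcirc hp j i (by simp) (by simp)) (hcirc hq j i (by simp) (by simp))
    · exact iff_of_false (hcirc hp k i (by simp) (by simp)) (hcirc hq k i (by simp) (by simp))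
    · exact iff_of_false (hcirc' i j k) (hcirc' i j k)

theorem exists_cutLt_sequence {b : N} (hb : Pt b) :
    ∃ e : ℕ → N, (∀ n, Pt (e n) ∧ fib (e n) = fib b) ∧ ∀ m n, m < n → CutLt b (e m) (e n) := by
  choose next hnext using fun x : {x : N // Pt x ∧ fib x = fib b} => h.cutLt_exists_gt hb x.2
  let e (n : ℕ) : {x : N // Pt x ∧ fib x = fib b} :=
    Nat.rec ⟨b, hb, rfl⟩ (fun _ x => ⟨next x, (hnext x).2.1⟩) n
  refine ⟨fun n => (e n).1, fun n => (e n).2, fun m n hmn => ?_⟩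
  induction n, hmn using Nat.le_induction with
  | base => exact hnext (e m)
  | succ n _ ih => exact h.cutLt_trans ih (hnext (e n))

/-- The half-open arcs from `e (2 * i)` to `e (2 * i + 1)` along an increasing sequence are pairwise
disjoint, and their end points are conjugate to `y` over `A` by `sim_of_fibre`. This gives
2-inconsistency. -/
theorem divides_arcFormula [Nonempty N] {A : Set N} {s : N} (hA : ∀ c ∈ A, Pt c → fib c ≠ s)
    {y : Fin 2 → N} (hy : ∀ j, Pt (y j) ∧ fib (y j) = s) (hyi : Function.Injective y) :
    Divides A arcFormula y := by
  obtain ⟨hb, hbs⟩ := hy 0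
  obtain ⟨e, he, hlt⟩ := h.exists_cutLt_sequence hb
  refine ⟨2, fun i => ![e (2 * i), e (2 * i + 1)], fun i φ => ?_, ?_⟩
  · have hei : Function.Injective ![e (2 * i), e (2 * i + 1)] := by
      have := (hlt _ _ (Nat.lt_succ_self (2 * i))).2.2.1
      intro j k
      fin_cases j <;> fin_cases k <;> simp [this, this.symm]
    refine (h.sim_of_fibre (fun c : A => hA c c.2) ?_ hy hei hyi).formula_realize_iff h h φ
    intro j
    fin_cases j
    exacts [hbs ▸ he _, hbs ▸ he _]
  -- Such an arc does not wrap around the cutting point `y 0`, so it is an interval of the cut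
  -- order.
  · have arc {i : ℕ} {x : N} (hx : x = e (2 * i) ∨
        Circ (e (2 * i)) x (e (2 * i + 1)) (fib (e (2 * i)))) :
        CutLt (y 0) x (e (2 * i + 1)) ∧ ¬ CutLt (y 0) x (e (2 * i)) := by
      have hi := hlt _ _ (Nat.lt_succ_self (2 * i))
      rcases hx with rfl | hx
      · exact ⟨hi, fun hc => hc.2.2.1 rfl⟩
      · rcases (h.circ_iff_cutLt hb (he _).2.symm).1 hx with hc | hc | hc
        · exact ⟨hc.2, h.cutLt_asymm hc.1⟩
        · exact absurd hi (h.cutLt_asymm hc.2)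
        · exact absurd hi (h.cutLt_asymm hc.1)
    have key {i j : ℕ} (hij : i < j) {x : N}
        (hi : x = e (2 * i) ∨ Circ (e (2 * i)) x (e (2 * i + 1)) (fib (e (2 * i))))
        (hj : x = e (2 * j) ∨ Circ (e (2 * j)) x (e (2 * j + 1)) (fib (e (2 * j)))) : False :=
      (arc hj).2 (h.cutLt_trans (arc hi).1 (hlt _ _ (by omega)))
    intro t ht
    rintro ⟨x, hx⟩
    obtain ⟨i, j, hij, rfl⟩ := Finset.card_eq_two.1 ht
    have hi := (realize_arcFormula _ _).1 (hx i (by simp))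
    have hj := (realize_arcFormula _ _).1 (hx j (by simp))
    rcases lt_or_gt_of_ne hij with hij | hij
    exacts [key hij hi hj, key hij hj hi]

/-- The arcs from `b` to `b'` and from `b'` to `b` cover the circle; each contains its initial
point, so no end point is missed. -/
theorem forks_fibreFormula [Nonempty N] {A : Set N} {s : N} (hs : InSets s)
    (hA : ∀ c ∈ A, Pt c → fib c ≠ s) : Forks A fibreFormula ![s] := by
  obtain ⟨b, hb, hbs, -⟩ := h.exists_fib hs 0 Fin.elim0
  obtain ⟨b', hb', hbs', hne⟩ := h.exists_fib hs 1 fun _ => b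
  have hne : b' ≠ b := hne 0
  refine ⟨2, fun _ => 2, fun _ => arcFormula, ![![b, b'], ![b', b] ],
    fun x hx => ?_, fun i => ?_⟩
  · obtain ⟨hx, hxs⟩ := (realize_fibreFormula x s).1 hx
    simp only [realize_arcFormula, Fin.exists_fin_two, Matrix.cons_val_zero, Matrix.cons_val_one,
      hbs, hbs']
    by_cases h₁ : x 0 = b
    · exact .inl (.inl h₁)
    by_cases h₂ : x 0 = b'
    · exact .inr (.inl h₂)
    exact (h.circ_total hb hbs hx hxs hb' hbs' (Ne.symm h₁) h₂ hne.symm).imp .inr .inr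
  · refine h.divides_arcFormula (s := s) hA (fun j => ?_) ?_
    · fin_cases i <;> fin_cases j
      exacts [⟨hb, hbs⟩, ⟨hb', hbs'⟩, ⟨hb', hbs'⟩, ⟨hb, hbs⟩]
    · intro j k
      fin_cases i <;> fin_cases j <;> fin_cases k <;> simp [hne, hne.symm]

/-- The formula identifying the parameter with `s` is over `A`, so every conjugate equals `s` and
the sequence of instances is constant and consistent. -/
theorem not_divides_fibreFormula {A : Set N} {s : N} (hs : InSets s) (hA : s ∈ A) :
    ¬ Divides A fibreFormula ![s] := by
  rintro ⟨k, a, ha, hk⟩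
  have has (i : ℕ) : a i = ![s] := by
    have := (ha i (Term.equal (var (.inl ⟨s, hA⟩)) (var (.inr 0)))).2 (by simp)
    funext j
    fin_cases j
    simpa using this.symm
  obtain ⟨b, hb, hbs, -⟩ := h.exists_fib hs 0 Fin.elim0
  refine hk (Finset.range k) (by simp) ⟨fun _ => b, fun i _ => ?_⟩
  rw [has i, realize_fibreFormula]
  exact ⟨hb, hbs⟩

theorem not_isExtensionBase [Nonempty N] {A : Set N} {s : N} (hs : InSets s) (hsA : s ∈ A)
    (hA : ∀ c ∈ A, Pt c → fib c ≠ s) : ¬ IsExtensionBase Lang A := fun hbase => by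
  obtain ⟨b, hb, hbs, -⟩ := h.exists_fib hs 0 Fin.elim0
  refine hbase 1 (fun _ => b) 1 fibreFormula ![s] (fun j => ?_) ?_ (h.forks_fibreFormula hs hA)
  · fin_cases j
    exact .inl hsA
  · exact (realize_fibreFormula _ s).2 ⟨hb, hbs⟩

theorem fib_ne_of_notMem (M : Lang.ElementarySubstructure N) {s : N} (hs : InSets s)
    (hsM : s ∉ M) : ∀ c ∈ (M : Set N) ∪ {s}, Pt c → fib c ≠ s := by
  rintro c (hc | rfl) hpt hcs
  · subst hcs
    exact hsM (M.toSubstructure.fun_mem Func.f ![c] fun i => by fin_cases i; exact hc)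
  · exact h.not_pt hs hpt

theorem exists_inSets_notMem [Nonempty N] {κ : Cardinal.{u}} (hN : IsSaturated Lang N κ)
    {A : Set N} (hA : Cardinal.mk A < κ) : ∃ s : N, InSets s ∧ s ∉ A := by
  let ne (c : A) : Lang.Formula (A ⊕ Unit) := (Term.equal (var (.inr ())) (var (.inl c))).not
  have hne (c : A) (x : N) :
      (ne c).Realize (Sum.elim (fun c : A => (c : N)) fun _ => x) ↔ x ≠ c := by
    simp [ne]
  let set : Lang.Formula (A ⊕ Unit) := Relations.formula₁ (L := Lang) Rel.set (var (.inr ()))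
  have hset (x : N) : set.Realize
      (Sum.elim (fun c : A => (c : N)) fun _ => x) ↔ InSets x :=
    Formula.realize_rel₁
  obtain ⟨s, hs⟩ := hN A hA ({set} ∪ Set.range ne) fun q hq => by
    -- Each formula of the type excludes at most one element of the sort of sets, which is infinite.
    have hfin : (⋃ φ ∈ q, {x : N | InSets x ∧
        ¬ φ.Realize (Sum.elim (fun c : A => (c : N)) fun _ => x)}).Finite := by
      refine q.finite_toSet.biUnion fun φ hφ => ?_
      rcases hq hφ with rfl | ⟨c, rfl⟩
      · simp only [hset, and_not_self]
        exact Set.finite_empty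
      · refine (Set.finite_singleton (c : N)).subset fun x hx => ?_
        simpa [hne] using hx.2
    obtain ⟨x, hx, hxq⟩ := h.infinite_inSets.exists_notMem_finite hfin
    refine ⟨x, fun φ hφ => by_contra fun hn => hxq ?_⟩
    exact Set.mem_biUnion hφ ⟨hx, hn⟩
  refine ⟨s, (hset s).1 (hs _ (.inl rfl)), fun hsA => ?_⟩
  exact (hne ⟨s, hsA⟩ s).1 (hs _ (.inr ⟨_, rfl⟩)) rfl

end IsFibred

theorem infinite_elementarySubstructure [Nonempty N] [N ⊨ fibreTheory]
    (M : Lang.ElementarySubstructure N) : Infinite M :=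
  Set.infinite_univ_iff.1
    ((isFibred_of_model M).infinite_inSets.mono (Set.subset_univ _))

end

end ForkDiv

theorem mainTheorem12 :
    (ForkDiv.fibreTheory.IsComplete ∧
      ForkDiv.HasQE ForkDiv.fibreTheory ∧
      ForkDiv.IsDependent.{u} ForkDiv.fibreTheory) ∧
    (∃ (N : Type u) (_ : ForkDiv.Lang.Structure N) (M : ForkDiv.Lang.ElementarySubstructure N),
      Nonempty N ∧ N ⊨ ForkDiv.fibreTheory ∧
      ForkDiv.IsSaturated ForkDiv.Lang N (Order.succ (Cardinal.mk M))) ∧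
    (∀ (N : Type u) [ForkDiv.Lang.Structure N] [Nonempty N] [N ⊨ ForkDiv.fibreTheory]
      (M : ForkDiv.Lang.ElementarySubstructure N),
      ForkDiv.IsSaturated ForkDiv.Lang N (Order.succ (Cardinal.mk M)) →
      (∃ s : N, ForkDiv.InSets s ∧ s ∉ M) ∧
      (∀ s : N, ForkDiv.InSets s → s ∉ M →
        ForkDiv.Forks ((M : Set N) ∪ {s}) ForkDiv.fibreFormula ![s] ∧
        ¬ ForkDiv.Divides ((M : Set N) ∪ {s}) ForkDiv.fibreFormula ![s] ∧
        ¬ ForkDiv.IsExtensionBase ForkDiv.Lang ((M : Set N) ∪ {s})) ∧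
      ¬ ForkDiv.IsGoodExtensionBase ForkDiv.Lang (Order.succ (Cardinal.mk M)) (M : Set N)) := by
  refine ⟨⟨ForkDiv.isComplete_fibreTheory, ForkDiv.hasQE_fibreTheory,
    ForkDiv.isDependent_fibreTheory⟩, ForkDiv.exists_isSaturated, ?_⟩
  intro N _ _ _ M hN
  have h := ForkDiv.isFibred_of_model N
  obtain ⟨s, hs, hsM⟩ := h.exists_inSets_notMem hN (A := (M : Set N)) (Order.lt_succ _)
  refine ⟨⟨s, hs, hsM⟩, fun t ht htM => ?_, fun hgood => ?_⟩
  · have hA := h.fib_ne_of_notMem M ht htM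
    exact ⟨h.forks_fibreFormula ht hA, h.not_divides_fibreFormula ht (.inr rfl),
      h.not_isExtensionBase ht (.inr rfl) hA⟩
  · refine h.not_isExtensionBase hs (.inr rfl) (h.fib_ne_of_notMem M hs hsM)
      (hgood _ Set.subset_union_left ?_)
    -- Since `M` is infinite, adding `s` keeps the base small.
    have := ForkDiv.infinite_elementarySubstructure M
    refine Order.lt_succ_iff.2 ((Cardinal.mk_union_le _ _).trans ?_)
    rw [Cardinal.mk_singleton]
    exact Cardinal.add_le_of_le (Cardinal.aleph0_le_mk M) le_rfl
      (Cardinal.one_le_aleph0.trans (Cardinal.aleph0_le_mk M))
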